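/- **Setting.** A system $(A,C)$ with $A\in\mathbb R^{n\times n}$, $C\in\mathbb R^{p\times n}$ is $\dot x(t)=Ax(t)$, $w(t)=Cx(t)$, $t\ge 0$. Two systems $(A_1,C_1)$ and $(A_2,C_2)$ with the same state dimension and the same $p$ are *topologically equivalent* if there is a homeomorphism $H$ of $\mathbb R^n$ such that, whenever $x$ is a solution of the first system with observation $w$, $y(t)=H(x(t))$ is a solution of the second with the same observation $w$, and likewise $H^{-1}$ takes solutions of the second system to solutions of the first with the same observation. They are *linearly equivalent* if $H$ can be chosen to be a linear isomorphism. Let $k_{obs}(A,C)$ be the rank of the matrix with block rows $C,CA,\dots,CA^{n-1}$; $(A,C)$ is *completely observable* if $k_{obs}(A,C)=n$. A *linear equivalence canonical form* for a class of systems is a set of systems in the class such that each system of the class is linearly equivalent to exactly one member of the set, called its canonical form. **Theorem.** Every system $(A,C)$ is linearly equivalent to a system $$\left(\begin{bmatrix}A^0&0&0\\0&A^+&0\\0&0&A^-\end{bmatrix},\ \begin{bmatrix}C^0&C^+&C^-\end{bmatrix}\right)$$ in which all eigenvalues of $A^0$, $A^+$, $A^-$ have zero, positive and negative real part, respectively.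 Given any such decomposition, let $n^0,n^+,n^-$ be the sizes of $A^0,A^+,A^-$, and put $k^+=k_{obs}(A^+,C^+)\le n^+$, $k^-=k_{obs}(A^-,C^-)\le n^-$. Fix any linear equivalence canonical form for the systems of state dimension $n^0$ (and $p$ outputs) all of whose eigenvalues have zero real part, and any linear equivalence canonical form for the completely observable systems of state dimension $k^++k^-$ (and $p$ outputs) all of whose eigenvalues have nonzero real part. Then $(A,C)$ is topologically equivalent to $$\left(\begin{bmatrix}\widehat N&0&0\\0&\widehat B&0\\0&0&\widehat E\end{bmatrix},\ \begin{bmatrix}\widehat K&\widehat D&0\end{bmatrix}\right),\qquad \widehat E=\operatorname{diag}(\underbrace{1,\dots,1}_{n^+-k^+},\underbrace{-1,\dots,-1}_{n^--k^-}),$$ for some $\widehat N\in\mathbb R^{n^0\times n^0}$, $\widehat K\in\mathbb R^{p\times n^0}$, $\widehat B\in\mathbb R^{(k^++k^-)\times(k^++k^-)}$, $\widehat D\in\mathbb R^{p\times(k^++k^-)}$ such that $(\widehat N,\widehat K)$ is the canonical form of $(A^0,C^0)$ in the first family, and $(\widehat B,\widehat D)$ belongs to the second family and is an observable part of $\left(\begin{bmatrix}A^+&0\\0&A^-\end{bmatrix},\begin{bmatrix}C^+&C^-\end{bmatrix}\right)$,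 i.e. the latter system is linearly equivalent to $\left(\begin{bmatrix}\widehat B&0\\A_m&A_u\end{bmatrix},\begin{bmatrix}\widehat D&0\end{bmatrix}\right)$ for some matrices $A_m,A_u$. -/

import Mathlib

open Matrix

/-- A linear system with observation `x' = A x`, `w = C x` for `t ≥ 0`, with state space `ℝ^ι` and
observation space `ℝ^p`; it is the pair of matrices `(A, C)`. -/
@[ext]
structure ObsSystem (ι : Type*) (p : ℕ) where
  A : Matrix ι ι ℝ
  C : Matrix (Fin p) ι ℝ

namespace ObsSystem

variable {ι κ : Type*} {p : ℕ}

section Equivalence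

variable [Fintype ι] [Fintype κ]

/-- `x` solves `x' = A x` on `[0, ∞)` and `w` is the corresponding observation. -/
def IsTrajectory (S : ObsSystem ι p) (x : ℝ → ι → ℝ) (w : ℝ → Fin p → ℝ) : Prop :=
  ∀ t : ℝ, 0 ≤ t → HasDerivWithinAt x (S.A *ᵥ x t) (Set.Ici 0) t ∧ w t = S.C *ᵥ x t

/-- The transformation `(y, z) = (H x, w)` brings the system `S` to the system `T`. -/
def Brings (S : ObsSystem ι p) (T : ObsSystem κ p) (H : (ι → ℝ) → (κ → ℝ)) : Prop :=
  ∀ (x : ℝ → ι → ℝ) (w : ℝ → Fin p → ℝ),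
    S.IsTrajectory x w → T.IsTrajectory (fun t => H (x t)) w

/-- Topological equivalence of systems with observation. -/
def TopEquiv (S : ObsSystem ι p) (T : ObsSystem κ p) : Prop :=
  ∃ H : (ι → ℝ) ≃ₜ (κ → ℝ), Brings S T H ∧ Brings T S H.symm

/-- Linear equivalence of systems with observation. -/
def LinEquiv (S : ObsSystem ι p) (T : ObsSystem κ p) : Prop :=
  ∃ H : (ι → ℝ) ≃ₗ[ℝ] (κ → ℝ), Brings S T H ∧ Brings T S H.symm

end Equivalence

/-- The block-diagonal system `(diag(A₁, A₂), [C₁ C₂])`. -/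
def join (S : ObsSystem ι p) (T : ObsSystem κ p) : ObsSystem (ι ⊕ κ) p where
  A := fromBlocks S.A 0 0 T.A
  C := fromCols S.C T.C

section Indices

variable [Fintype ι] [DecidableEq ι] [Fintype κ] [DecidableEq κ]

/-- The observability matrix, with block rows `C, C A, …, C A^(n-1)` for `n = |ι|`. -/
def obsMatrix (S : ObsSystem ι p) : Matrix (Fin (Fintype.card ι) × Fin p) ι ℝ :=
  Matrix.of fun i j => (S.C * S.A ^ (i.1 : ℕ)) i.2 j

/-- The Kalman rank of observability. -/
noncomputable def kobs (S : ObsSystem ι p) : ℕ := S.obsMatrix.rank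

def CompletelyObservable (S : ObsSystem ι p) : Prop := S.kobs = Fintype.card ι

/-- All complex eigenvalues of the state matrix satisfy the predicate `P`. -/
def EigenvaluesSatisfy (S : ObsSystem ι p) (P : ℂ → Prop) : Prop :=
  ∀ z ∈ spectrum ℂ (S.A.map (algebraMap ℝ ℂ)), P z

/-- All eigenvalues have zero real part. -/
def ZeroRealParts (S : ObsSystem ι p) : Prop := S.EigenvaluesSatisfy fun z => z.re = 0

/-- All eigenvalues have nonzero real part. -/
def NonzeroRealParts (S : ObsSystem ι p) : Prop := S.EigenvaluesSatisfy fun z => z.re ≠ 0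

/-- A linear equivalence canonical form for the class `P` of systems: a set of systems of the class
such that each system of the class is linearly equivalent to exactly one member of the set. -/
def IsLinearCanonicalForm (P : ObsSystem ι p → Prop) (R : Set (ObsSystem ι p)) : Prop :=
  (∀ T ∈ R, P T) ∧ ∀ S, P S → ∃! T, T ∈ R ∧ S.LinEquiv T

/-- `T` is the observable part `(A_o, C_o)` in a Kalman decomposition
`(A_o, 0; A_m, A_u), [C_o 0]` of `S`. -/
def IsObservablePart (S : ObsSystem ι p) (T : ObsSystem κ p) : Prop :=
  T.CompletelyObservable ∧
    ∃ (m : ℕ) (Am : Matrix (Fin m) κ ℝ) (Au : Matrix (Fin m) (Fin m) ℝ),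
      S.LinEquiv (⟨fromBlocks T.A 0 Am Au, fromCols T.C 0⟩ : ObsSystem (κ ⊕ Fin m) p)

/-- A decomposition of `S`, up to linear equivalence, as
`(diag(A⁰, A⁺, A⁻), [C⁰ C⁺ C⁻])`, where the eigenvalues of `A⁰`, `A⁺`, `A⁻` have zero, positive and
negative real parts. The sizes of the blocks are `n⁰`, `n⁺`, `n⁻`. -/
structure SpectralDecomposition (S : ObsSystem ι p) where
  nZero : ℕ
  nPos : ℕ
  nNeg : ℕ
  zero : ObsSystem (Fin nZero) p
  pos : ObsSystem (Fin nPos) p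
  neg : ObsSystem (Fin nNeg) p
  zero_re : zero.EigenvaluesSatisfy fun z => z.re = 0
  pos_re : pos.EigenvaluesSatisfy fun z => 0 < z.re
  neg_re : neg.EigenvaluesSatisfy fun z => z.re < 0
  linEquiv : S.LinEquiv (zero.join (pos.join neg))

end Indices

/-- The unobserved system `(Ê, 0)`, where `Ê = diag(1, …, 1, -1, …, -1)` with `a` entries `1` and
`b` entries `-1`. -/
def signSystem (a b p : ℕ) : ObsSystem (Fin a ⊕ Fin b) p where
  A := Matrix.diagonal (Sum.elim (fun _ => 1) (fun _ => -1))
  C := 0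

end ObsSystem

/-
Splitting the state space by the sign of the real parts of the eigenvalues reduces the theorem to
the two hyperbolic blocks. On the block with eigenvalues of positive real part, pass to a Kalman
decomposition `(A_o 0; A_m A_u), [C_o 0]` and rescale so that `A_m` becomes small. In a suitable
Euclidean norm the vector fields of this system and of `(A_o 0; 0 1)` are both expanding, so every
nonzero orbit crosses the unit sphere exactly once, and matching the two flows along the sphere
gives a homeomorphism that conjugates one flow to the other. Both flows project onto the flow of
`A_o`, so flowing forward with the one and backward with the other does not change the projection,
and hence does not change the observation. Time reversal handles the other hyperbolic block, and
uniqueness of the observable part identifies the observable parts of the two blocks, taken together,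
with the prescribed normal form.
-/

section LinearFlow

variable {E F : Type*} [NormedAddCommGroup E] [NormedSpace ℝ E]
  [NormedAddCommGroup F] [NormedSpace ℝ F]

/-- The flow `t ↦ exp (t A)` of the linear vector field `A`. -/
noncomputable def linearFlow (A : E →L[ℝ] E) (t : ℝ) : E →L[ℝ] E := NormedSpace.exp (t • A)

@[simp]
theorem linearFlow_zero (A : E →L[ℝ] E) (x : E) : linearFlow A 0 x = x := by
  simp [linearFlow]

theorem linearFlow_neg_left (A : E →L[ℝ] E) (t : ℝ) : linearFlow (-A) t = linearFlow A (-t) := by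
  simp [linearFlow]

variable [CompleteSpace E]

theorem linearFlow_add (A : E →L[ℝ] E) (s t : ℝ) (x : E) :
    linearFlow A (s + t) x = linearFlow A s (linearFlow A t x) := by
  let _ : NormedAlgebra ℚ (E →L[ℝ] E) := NormedAlgebra.restrictScalars ℚ ℝ _
  have h : Commute (s • A) (t • A) := ((Commute.refl A).smul_left s).smul_right t
  rw [linearFlow, add_smul, NormedSpace.exp_add_of_commute h]
  rfl

@[simp]
theorem linearFlow_neg_apply_self (A : E →L[ℝ] E) (t : ℝ) (x : E) :
    linearFlow A (-t) (linearFlow A t x) = x := by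
  rw [← linearFlow_add, neg_add_cancel, linearFlow_zero]

@[simp]
theorem linearFlow_apply_neg_self (A : E →L[ℝ] E) (t : ℝ) (x : E) :
    linearFlow A t (linearFlow A (-t) x) = x := by
  rw [← linearFlow_add, add_neg_cancel, linearFlow_zero]

theorem linearFlow_ne_zero (A : E →L[ℝ] E) (t : ℝ) {x : E} (hx : x ≠ 0) :
    linearFlow A t x ≠ 0 := fun h => hx <| by
  rw [← linearFlow_neg_apply_self A t x, h, map_zero]

theorem hasDerivAt_linearFlow (A : E →L[ℝ] E) (x : E) (t : ℝ) :
    HasDerivAt (fun s => linearFlow A s x) (A (linearFlow A t x)) t := by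
  simpa [linearFlow] using (hasDerivAt_exp_smul_const' A t).clm_apply (hasDerivAt_const t x)

theorem continuous_linearFlow (A : E →L[ℝ] E) :
    Continuous fun q : ℝ × E => linearFlow A q.1 q.2 := by
  let _ : NormedAlgebra ℚ (E →L[ℝ] E) := NormedAlgebra.restrictScalars ℚ ℝ _
  have h : Continuous fun q : ℝ × E => NormedSpace.exp (q.1 • A) :=
    NormedSpace.exp_continuous.comp (by fun_prop)
  exact h.clm_apply continuous_snd

theorem eq_linearFlow_of_hasDerivWithinAt {A : E →L[ℝ] E} {x : ℝ → E}
    (hx : ∀ t, 0 ≤ t → HasDerivWithinAt x (A (x t)) (Set.Ici 0) t) {t : ℝ} (ht : 0 ≤ t) :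
    x t = linearFlow A t (x 0) := by
  have hd : ∀ s, 0 ≤ s →
      HasDerivWithinAt (fun s => linearFlow (-A) s (x s)) 0 (Set.Ici 0) s := by
    intro s hs
    have h := ((hasDerivAt_exp_smul_const (-A) s).hasDerivWithinAt (s := Set.Ici 0)).clm_apply
      (hx s hs)
    simpa [linearFlow] using h
  have hc := constant_of_has_deriv_right_zero (f := fun s => linearFlow (-A) s (x s)) (a := 0)
    (b := t) (fun s hs => ((hd s hs.1).continuousWithinAt).mono Set.Icc_subset_Ici_self)
    (fun s hs => (hd s hs.1).mono (Set.Ici_subset_Ici.2 hs.1)) t ⟨ht, le_rfl⟩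
  simp only [linearFlow_neg_left, neg_zero, linearFlow_zero] at hc
  rw [← hc, linearFlow_apply_neg_self]

variable [CompleteSpace F]

theorem linearFlow_semiconj_of_nonneg {A : E →L[ℝ] E} {B : F →L[ℝ] F} {H : E → F}
    (h : ∀ t, 0 ≤ t → ∀ x, H (linearFlow A t x) = linearFlow B t (H x)) (t : ℝ) (x : E) :
    H (linearFlow A t x) = linearFlow B t (H x) := by
  rcases le_total 0 t with ht | ht
  · exact h t ht x
  · have hx := h (-t) (neg_nonneg.2 ht) (linearFlow A t x)
    rw [linearFlow_neg_apply_self] at hx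
    rw [hx, linearFlow_apply_neg_self]

theorem map_linearFlow {A : E →L[ℝ] E} {B : F →L[ℝ] F} {P : E →L[ℝ] F}
    (h : ∀ x, P (A x) = B (P x)) (t : ℝ) (x : E) :
    P (linearFlow A t x) = linearFlow B t (P x) := by
  refine linearFlow_semiconj_of_nonneg (H := P) (fun t ht x => ?_) t x
  have hsol : ∀ s, HasDerivAt (fun s => P (linearFlow A s x)) (B (P (linearFlow A s x))) s :=
    fun s => h (linearFlow A s x) ▸ P.hasFDerivAt.comp_hasDerivAt s (hasDerivAt_linearFlow A x s)
  simpa using eq_linearFlow_of_hasDerivWithinAt (fun s _ => (hsol s).hasDerivWithinAt) ht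

end LinearFlow

namespace ObsSystem

section Morphisms

variable {ι κ ι' κ' μ : Type*} {p : ℕ}
  [Fintype ι] [Fintype κ] [Fintype ι'] [Fintype κ'] [Fintype μ]

/-- The vector field `x ↦ A x` of a system as a continuous linear map. -/
noncomputable def field (S : ObsSystem ι p) : (ι → ℝ) →L[ℝ] (ι → ℝ) :=
  S.A.mulVecLin.toContinuousLinearMap

@[simp]
theorem field_apply (S : ObsSystem ι p) (x : ι → ℝ) : S.field x = S.A *ᵥ x := rfl

theorem isTrajectory_linearFlow (S : ObsSystem ι p) (x : ι → ℝ) :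
    S.IsTrajectory (fun t => linearFlow S.field t x) (fun t => S.C *ᵥ linearFlow S.field t x) :=
  fun t _ => ⟨(hasDerivAt_linearFlow S.field x t).hasDerivWithinAt, rfl⟩

theorem IsTrajectory.eq_linearFlow {S : ObsSystem ι p} {x : ℝ → ι → ℝ} {w : ℝ → Fin p → ℝ}
    (h : S.IsTrajectory x w) {t : ℝ} (ht : 0 ≤ t) : x t = linearFlow S.field t (x 0) :=
  eq_linearFlow_of_hasDerivWithinAt (A := S.field) (fun s hs => (h s hs).1) ht

theorem brings_iff {S : ObsSystem ι p} {T : ObsSystem κ p} {H : (ι → ℝ) → (κ → ℝ)} :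
    Brings S T H ↔ (∀ t x, H (linearFlow S.field t x) = linearFlow T.field t (H x)) ∧
      ∀ x, T.C *ᵥ H x = S.C *ᵥ x := by
  refine ⟨fun h => ⟨linearFlow_semiconj_of_nonneg fun t ht x => ?_, fun x => ?_⟩,
    fun ⟨hA, hC⟩ x w hx t ht => ⟨?_, by rw [hC, (hx t ht).2]⟩⟩
  · simpa using (h _ _ (S.isTrajectory_linearFlow x)).eq_linearFlow ht
  · simpa using (h _ _ (S.isTrajectory_linearFlow x) 0 le_rfl).2.symm
  · have hsol : ∀ s, 0 ≤ s → H (x s) = linearFlow T.field s (H (x 0)) := fun s hs => by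
      rw [← hA, ← hx.eq_linearFlow hs]
    have hd := (hasDerivAt_linearFlow T.field (H (x 0)) t).hasDerivWithinAt (s := Set.Ici 0)
    rw [← hsol t ht] at hd
    exact hd.congr (fun s hs => hsol s hs) (hsol t ht)

theorem topEquiv_iff {S : ObsSystem ι p} {T : ObsSystem κ p} :
    S.TopEquiv T ↔ ∃ H : (ι → ℝ) ≃ₜ (κ → ℝ),
      (∀ t x, H (linearFlow S.field t x) = linearFlow T.field t (H x)) ∧
        ∀ x, T.C *ᵥ H x = S.C *ᵥ x := by
  refine exists_congr fun H => ⟨fun h => brings_iff.1 h.1, fun h => ⟨brings_iff.2 h, ?_⟩⟩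
  refine brings_iff.2 ⟨fun t y => ?_, fun y => ?_⟩
  · rw [Homeomorph.symm_apply_eq, h.1, H.apply_symm_apply]
  · rw [← h.2, H.apply_symm_apply]

/-- A morphism of systems: a linear map of state spaces that carries the vector field of `S` to that
of `T` and leaves the observation unchanged. -/
structure Intertwines (S : ObsSystem ι p) (T : ObsSystem κ p)
    (H : (ι → ℝ) →ₗ[ℝ] (κ → ℝ)) : Prop where
  map_state : ∀ x, H (S.A *ᵥ x) = T.A *ᵥ H x
  output_map : ∀ x, T.C *ᵥ H x = S.C *ᵥ x

namespace Intertwines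

variable {S : ObsSystem ι p} {T : ObsSystem κ p} {U : ObsSystem μ p} {H : (ι → ℝ) →ₗ[ℝ] (κ → ℝ)}

theorem comp {G : (κ → ℝ) →ₗ[ℝ] (μ → ℝ)} (hG : Intertwines T U G) (hH : Intertwines S T H) :
    Intertwines S U (G ∘ₗ H) where
  map_state x := by simp [hH.map_state, hG.map_state]
  output_map x := by simp [hG.output_map, hH.output_map]

theorem symm {H : (ι → ℝ) ≃ₗ[ℝ] (κ → ℝ)} (h : Intertwines S T H.toLinearMap) :
    Intertwines T S H.symm.toLinearMap where
  map_state y := by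
    have hy := h.map_state (H.symm y)
    simp only [LinearEquiv.coe_coe, LinearEquiv.apply_symm_apply] at hy ⊢
    rw [← hy, LinearEquiv.symm_apply_apply]
  output_map y := by simpa using (h.output_map (H.symm y)).symm

theorem coprod {R₁ : ObsSystem ι p} {R₂ : ObsSystem κ p} {S : ObsSystem μ p}
    {φ : (ι → ℝ) →ₗ[ℝ] (μ → ℝ)} {ψ : (κ → ℝ) →ₗ[ℝ] (μ → ℝ)}
    (hφ : Intertwines R₁ S φ) (hψ : Intertwines R₂ S ψ) :
    Intertwines (R₁.join R₂) S
      (φ.coprod ψ ∘ₗ (LinearEquiv.sumArrowLequivProdArrow ι κ ℝ ℝ).toLinearMap) where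
  map_state x := by
    change φ (((R₁.join R₂).A *ᵥ x) ∘ Sum.inl) + ψ (((R₁.join R₂).A *ᵥ x) ∘ Sum.inr) =
      S.A *ᵥ (φ (x ∘ Sum.inl) + ψ (x ∘ Sum.inr))
    simp [join, fromBlocks_mulVec, mulVec_add, hφ.map_state, hψ.map_state]
  output_map x := by
    change S.C *ᵥ (φ (x ∘ Sum.inl) + ψ (x ∘ Sum.inr)) = (R₁.join R₂).C *ᵥ x
    simp [join, fromCols_mulVec, mulVec_add, hφ.output_map, hψ.output_map]

theorem of_comp {G : (κ → ℝ) →ₗ[ℝ] (μ → ℝ)} (hGH : Intertwines S U (G ∘ₗ H))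
    (hH : Intertwines S T H) (hsurj : Function.Surjective H) : Intertwines T U G where
  map_state := hsurj.forall.2 fun x => by
    simpa [← hH.map_state] using hGH.map_state x
  output_map := hsurj.forall.2 fun x => by
    simpa [hH.output_map] using hGH.output_map x

theorem brings (h : Intertwines S T H) : Brings S T H :=
  brings_iff.2 ⟨map_linearFlow (P := H.toContinuousLinearMap) (A := S.field) (B := T.field)
    h.map_state, h.output_map⟩

theorem of_brings (h : Brings S T H) : Intertwines S T H where
  map_state x := by
    have hleft := H.toContinuousLinearMap.hasFDerivAt.comp_hasDerivAt 0
      (hasDerivAt_linearFlow S.field x 0)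
    have hright := hasDerivAt_linearFlow T.field (H x) 0
    rw [← funext fun t => (brings_iff.1 h).1 t x] at hright
    simpa using hleft.unique hright
  output_map := (brings_iff.1 h).2

end Intertwines

theorem linEquiv_iff {S : ObsSystem ι p} {T : ObsSystem κ p} :
    S.LinEquiv T ↔ ∃ H : (ι → ℝ) ≃ₗ[ℝ] (κ → ℝ), Intertwines S T H.toLinearMap :=
  exists_congr fun _ =>
    ⟨fun h => .of_brings h.1, fun h => ⟨h.brings, h.symm.brings⟩⟩

theorem LinEquiv.refl (S : ObsSystem ι p) : S.LinEquiv S :=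
  ⟨LinearEquiv.refl ℝ _, fun _ _ h => h, fun _ _ h => h⟩

theorem LinEquiv.symm {S : ObsSystem ι p} {T : ObsSystem κ p} (h : S.LinEquiv T) :
    T.LinEquiv S :=
  let ⟨H, h₁, h₂⟩ := h
  ⟨H.symm, h₂, h₁⟩

theorem LinEquiv.trans {S : ObsSystem ι p} {T : ObsSystem κ p} {U : ObsSystem μ p}
    (h : S.LinEquiv T) (h' : T.LinEquiv U) : S.LinEquiv U :=
  let ⟨H, h₁, h₂⟩ := h
  let ⟨G, g₁, g₂⟩ := h'
  ⟨H.trans G, fun x w hx => g₁ _ _ (h₁ x w hx), fun x w hx => h₂ _ _ (g₂ x w hx)⟩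

theorem TopEquiv.trans {S : ObsSystem ι p} {T : ObsSystem κ p} {U : ObsSystem μ p}
    (h : S.TopEquiv T) (h' : T.TopEquiv U) : S.TopEquiv U :=
  let ⟨H, h₁, h₂⟩ := h
  let ⟨G, g₁, g₂⟩ := h'
  ⟨H.trans G, fun x w hx => g₁ _ _ (h₁ x w hx), fun x w hx => h₂ _ _ (g₂ x w hx)⟩

theorem LinEquiv.topEquiv {S : ObsSystem ι p} {T : ObsSystem κ p} (h : S.LinEquiv T) :
    S.TopEquiv T :=
  let ⟨H, h₁, h₂⟩ := h
  ⟨H.toContinuousLinearEquiv.toHomeomorph, h₁, h₂⟩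

theorem linearFlow_join (S : ObsSystem ι p) (T : ObsSystem κ p) (t : ℝ) (x : ι ⊕ κ → ℝ) :
    linearFlow (S.join T).field t x =
      Sum.elim (linearFlow S.field t (x ∘ Sum.inl)) (linearFlow T.field t (x ∘ Sum.inr)) := by
  have hinl := map_linearFlow (A := (S.join T).field) (B := S.field)
    (P := (LinearMap.funLeft ℝ ℝ Sum.inl).toContinuousLinearMap)
    (fun x => by ext; simp [join, fromBlocks_mulVec, LinearMap.funLeft]) t x
  have hinr := map_linearFlow (A := (S.join T).field) (B := T.field)
    (P := (LinearMap.funLeft ℝ ℝ Sum.inr).toContinuousLinearMap)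
    (fun x => by ext; simp [join, fromBlocks_mulVec, LinearMap.funLeft]) t x
  ext (i | i)
  · exact congr_fun hinl i
  · exact congr_fun hinr i

theorem Brings.join {S : ObsSystem ι p} {S' : ObsSystem ι' p} {T : ObsSystem κ p}
    {T' : ObsSystem κ' p} {H : (ι → ℝ) → (ι' → ℝ)} {G : (κ → ℝ) → (κ' → ℝ)}
    (hH : Brings S S' H) (hG : Brings T T' G) :
    Brings (S.join T) (S'.join T')
      (fun x => Sum.elim (H (x ∘ Sum.inl)) (G (x ∘ Sum.inr))) := by
  obtain ⟨hHflow, hHout⟩ := brings_iff.1 hH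
  obtain ⟨hGflow, hGout⟩ := brings_iff.1 hG
  refine brings_iff.2 ⟨fun t x => ?_, fun x => ?_⟩
  · simp only [linearFlow_join, Sum.elim_comp_inl, Sum.elim_comp_inr, hHflow, hGflow]
  · simp only [ObsSystem.join, fromCols_mulVec, Sum.elim_comp_inl, Sum.elim_comp_inr, hHout, hGout]

theorem TopEquiv.join {S : ObsSystem ι p} {S' : ObsSystem ι' p} {T : ObsSystem κ p}
    {T' : ObsSystem κ' p} (h : S.TopEquiv S') (h' : T.TopEquiv T') :
    (S.join T).TopEquiv (S'.join T') :=
  let ⟨H, h₁, h₂⟩ := h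
  let ⟨G, g₁, g₂⟩ := h'
  ⟨Homeomorph.sumArrowHomeomorphProdArrow.trans
    ((H.prodCongr G).trans Homeomorph.sumArrowHomeomorphProdArrow.symm), h₁.join g₁, h₂.join g₂⟩

theorem LinEquiv.join {S : ObsSystem ι p} {S' : ObsSystem ι' p} {T : ObsSystem κ p}
    {T' : ObsSystem κ' p} (h : S.LinEquiv S') (h' : T.LinEquiv T') :
    (S.join T).LinEquiv (S'.join T') :=
  let ⟨H, h₁, h₂⟩ := h
  let ⟨G, g₁, g₂⟩ := h'
  ⟨(LinearEquiv.sumArrowLequivProdArrow ι κ ℝ ℝ).trans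
    ((H.prodCongr G).trans (LinearEquiv.sumArrowLequivProdArrow ι' κ' ℝ ℝ).symm),
    h₁.join g₁, h₂.join g₂⟩

theorem Intertwines.join {S : ObsSystem ι p} {S' : ObsSystem ι' p} {T : ObsSystem κ p}
    {T' : ObsSystem κ' p} {φ : (ι → ℝ) →ₗ[ℝ] (ι' → ℝ)} {ψ : (κ → ℝ) →ₗ[ℝ] (κ' → ℝ)}
    (hφ : Intertwines S S' φ) (hψ : Intertwines T T' ψ) :
    Intertwines (S.join T) (S'.join T')
      ((LinearEquiv.sumArrowLequivProdArrow ι' κ' ℝ ℝ).symm.toLinearMap ∘ₗ φ.prodMap ψ ∘ₗ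
        (LinearEquiv.sumArrowLequivProdArrow ι κ ℝ ℝ).toLinearMap) :=
  .of_brings (hφ.brings.join hψ.brings)

theorem linEquiv_reindex (S : ObsSystem ι p) (e : ι ≃ κ) :
    S.LinEquiv (⟨reindex e e S.A, S.C.submatrix id e.symm⟩ : ObsSystem κ p) := by
  refine linEquiv_iff.2 ⟨LinearEquiv.funCongrLeft ℝ ℝ e.symm, fun x => ?_, fun x => ?_⟩ <;>
  · ext i
    simp [LinearEquiv.funCongrLeft_apply, submatrix_mulVec_equiv, LinearMap.funLeft,
      Function.comp_assoc]

theorem linEquiv_join_join_join_comm (S : ObsSystem ι p) (T : ObsSystem κ p)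
    (S' : ObsSystem ι' p) (T' : ObsSystem κ' p) :
    ((S.join T).join (S'.join T')).LinEquiv ((S.join S').join (T.join T')) := by
  convert linEquiv_reindex _ (Equiv.sumSumSumComm ι κ ι' κ') using 1
  ext i j
  · rcases i with (i | i) | (i | i) <;> rcases j with (j | j) | (j | j) <;> rfl
  · rcases j with (j | j) | (j | j) <;> rfl

/-- The system `(-A, C)`, which is `(A, C)` with time reversed. -/
def reverse (S : ObsSystem ι p) : ObsSystem ι p := ⟨-S.A, S.C⟩

theorem linearFlow_reverse (S : ObsSystem ι p) (t : ℝ) :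
    linearFlow S.reverse.field t = linearFlow S.field (-t) := by
  have h : S.reverse.field = -S.field := by
    ext x : 1
    exact neg_mulVec _ _
  rw [h, linearFlow_neg_left]

theorem TopEquiv.reverse {S : ObsSystem ι p} {T : ObsSystem κ p} (h : S.TopEquiv T) :
    S.reverse.TopEquiv T.reverse := by
  obtain ⟨H, hflow, hout⟩ := topEquiv_iff.1 h
  refine topEquiv_iff.2 ⟨H, fun t x => ?_, hout⟩
  rw [linearFlow_reverse, linearFlow_reverse, hflow]

/-- The system `(A 0; L U), [C 0]`: a driven, unobserved subsystem `y' = L x + U y` is attached to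
`S = (A, C)`. -/
def extend (S : ObsSystem ι p) (L : Matrix κ ι ℝ) (U : Matrix κ κ ℝ) : ObsSystem (ι ⊕ κ) p :=
  ⟨fromBlocks S.A 0 L U, fromCols S.C 0⟩

theorem intertwines_extend (T : ObsSystem κ p) (L : Matrix μ κ ℝ) (U : Matrix μ μ ℝ) :
    Intertwines (T.extend L U) T (LinearMap.funLeft ℝ ℝ Sum.inl) where
  map_state x := by ext; simp [extend, fromBlocks_mulVec, LinearMap.funLeft]
  output_map x := by ext; simp [extend, fromCols_mulVec, LinearMap.funLeft]

theorem eq_extend_of_intertwines {R : ObsSystem (κ ⊕ μ) p} {T : ObsSystem κ p}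
    (h : Intertwines R T (LinearMap.funLeft ℝ ℝ Sum.inl)) :
    R = T.extend R.A.toBlocks₂₁ R.A.toBlocks₂₂ := by
  have hA (u : κ → ℝ) (v : μ → ℝ) : R.A.toBlocks₁₁ *ᵥ u + R.A.toBlocks₁₂ *ᵥ v = T.A *ᵥ u := by
    have huv := h.map_state (Sum.elim u v)
    rw [← fromBlocks_toBlocks R.A, fromBlocks_mulVec] at huv
    exact huv
  have hC (u : κ → ℝ) (v : μ → ℝ) : R.C.toCols₁ *ᵥ u + R.C.toCols₂ *ᵥ v = T.C *ᵥ u := by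
    have huv := h.output_map (Sum.elim u v)
    rw [← fromCols_toCols R.C, fromCols_mulVec] at huv
    exact huv.symm
  have hA₁ : R.A.toBlocks₁₁ = T.A := mulVec_injective <| funext fun u => by simpa using hA u 0
  have hA₂ : R.A.toBlocks₁₂ = 0 := mulVec_injective <| funext fun v => by simpa using hA 0 v
  have hC₁ : R.C.toCols₁ = T.C := mulVec_injective <| funext fun u => by simpa using hC u 0
  have hC₂ : R.C.toCols₂ = 0 := mulVec_injective <| funext fun v => by simpa using hC 0 v
  ext1
  · rw [extend, ← hA₁, ← hA₂, fromBlocks_toBlocks]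
  · rw [extend, ← hC₁, ← hC₂, fromCols_toCols]

section OfLinear

variable [DecidableEq κ] {V : Type*} [AddCommGroup V] [Module ℝ V]

/-- The vector field `f` and the observation `g` on a real vector space `V`, written as a system in
the coordinates `e`. -/
def ofLinear (f : V →ₗ[ℝ] V) (g : V →ₗ[ℝ] (Fin p → ℝ)) (e : V ≃ₗ[ℝ] (κ → ℝ)) : ObsSystem κ p :=
  ⟨LinearMap.toMatrix' (e.conj f), LinearMap.toMatrix' (g ∘ₗ e.symm.toLinearMap)⟩

theorem ofLinear_A_mulVec (f : V →ₗ[ℝ] V) (g : V →ₗ[ℝ] (Fin p → ℝ)) (e : V ≃ₗ[ℝ] (κ → ℝ))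
    (v : V) : (ofLinear f g e).A *ᵥ e v = e (f v) := by
  simp [ofLinear, ← toLin'_apply, LinearEquiv.conj_apply]

theorem ofLinear_C_mulVec (f : V →ₗ[ℝ] V) (g : V →ₗ[ℝ] (Fin p → ℝ)) (e : V ≃ₗ[ℝ] (κ → ℝ))
    (v : V) : (ofLinear f g e).C *ᵥ e v = g v := by
  simp [ofLinear, ← toLin'_apply]

end OfLinear

end Morphisms

end ObsSystem

section MatrixLemmas

variable {ι κ K R : Type*} [Fintype ι] [DecidableEq ι] [Fintype κ] [DecidableEq κ]

theorem spectrum_fromBlocks_zero₁₂ [Field K] (A : Matrix ι ι K) (L : Matrix κ ι K)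
    (D : Matrix κ κ K) : spectrum K (fromBlocks A 0 L D) = spectrum K A ∪ spectrum K D := by
  ext z
  simp only [Set.mem_union, mem_spectrum_iff_isRoot_charpoly, charpoly_fromBlocks_zero₁₂,
    Polynomial.root_mul]

theorem map_aeval_mulVec [CommRing R] {A : Matrix ι ι R} {B : Matrix κ κ R}
    {H : (ι → R) →ₗ[R] (κ → R)} (h : ∀ x, H (A *ᵥ x) = B *ᵥ H x) (q : Polynomial R) (x : ι → R) :
    H (Polynomial.aeval A q *ᵥ x) = Polynomial.aeval B q *ᵥ H x := by
  induction q using Polynomial.induction_on generalizing x with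
  | C a => simp [Algebra.algebraMap_eq_smul_one, smul_mulVec]
  | add q r hq hr => simp [add_mulVec, hq, hr]
  | monomial k a ih =>
    rw [pow_succ, ← mul_assoc, map_mul (Polynomial.aeval A), map_mul (Polynomial.aeval B),
      Polynomial.aeval_X, Polynomial.aeval_X, ← mulVec_mulVec, ← mulVec_mulVec, ih, h]

theorem pow_mem_span_pow_lt_card [Field K] (A : Matrix ι ι K) (k : ℕ) :
    A ^ k ∈ Submodule.span K ((A ^ ·) '' Set.Iio (Fintype.card ι)) := by
  rcases isEmpty_or_nonempty ι with hι | hι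
  · rw [Subsingleton.elim (A ^ k) 0]
    exact zero_mem _
  have hdeg : (Polynomial.X ^ k %ₘ A.charpoly).natDegree < Fintype.card ι := by
    rw [← A.charpoly_natDegree_eq_dim]
    refine Polynomial.natDegree_modByMonic_lt _ A.charpoly_monic fun h => ?_
    refine Fintype.card_ne_zero (α := ι) ?_
    rw [← A.charpoly_natDegree_eq_dim, h, Polynomial.natDegree_one]
  rw [pow_eq_aeval_mod_charpoly, Polynomial.aeval_eq_sum_range' hdeg]
  exact Submodule.sum_mem _ fun i hi => Submodule.smul_mem _ _ <| Submodule.subset_span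
    ⟨i, Finset.mem_range.1 hi, rfl⟩

end MatrixLemmas

namespace ObsSystem

variable {ι κ : Type*} {p : ℕ} [Fintype ι] [DecidableEq ι] [Fintype κ] [DecidableEq κ]

section Eigenvalues

theorem eigenvaluesSatisfy_iff_charpoly {S : ObsSystem ι p} {P : ℂ → Prop} :
    S.EigenvaluesSatisfy P ↔ ∀ z : ℂ, Polynomial.aeval z S.A.charpoly = 0 → P z := by
  simp only [EigenvaluesSatisfy, mem_spectrum_iff_isRoot_charpoly, charpoly_map,
    Polynomial.IsRoot.def, Polynomial.eval_map_algebraMap]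

theorem eigenvaluesSatisfy_extend {S : ObsSystem ι p} {L : Matrix κ ι ℝ} {U : Matrix κ κ ℝ}
    {P : ℂ → Prop} : (S.extend L U).EigenvaluesSatisfy P ↔
      S.EigenvaluesSatisfy P ∧ ∀ z ∈ spectrum ℂ (U.map (algebraMap ℝ ℂ)), P z := by
  simp [EigenvaluesSatisfy, extend, fromBlocks_map, spectrum_fromBlocks_zero₁₂, or_imp,
    forall_and]

theorem eigenvaluesSatisfy_join {S : ObsSystem ι p} {T : ObsSystem κ p} {P : ℂ → Prop} :
    (S.join T).EigenvaluesSatisfy P ↔ S.EigenvaluesSatisfy P ∧ T.EigenvaluesSatisfy P := by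
  simp [EigenvaluesSatisfy, join, fromBlocks_map, spectrum_fromBlocks_zero₁₂, or_imp, forall_and]

theorem EigenvaluesSatisfy.mono {S : ObsSystem ι p} {P Q : ℂ → Prop}
    (hS : S.EigenvaluesSatisfy P) (h : ∀ z, P z → Q z) : S.EigenvaluesSatisfy Q :=
  fun z hz => h z (hS z hz)

theorem EigenvaluesSatisfy.reverse {S : ObsSystem ι p} {P : ℂ → Prop}
    (hS : S.EigenvaluesSatisfy P) : S.reverse.EigenvaluesSatisfy fun z => P (-z) := by
  intro z hz
  have h : S.reverse.A.map (algebraMap ℝ ℂ) = -S.A.map (algebraMap ℝ ℂ) := by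
    ext; simp [ObsSystem.reverse]
  rw [h, ← spectrum.neg_eq, Set.mem_neg] at hz
  exact hS _ hz

theorem LinEquiv.charpoly_eq {S : ObsSystem ι p} {T : ObsSystem κ p} (h : S.LinEquiv T) :
    S.A.charpoly = T.A.charpoly := by
  obtain ⟨H, hH⟩ := linEquiv_iff.1 h
  rw [← charpoly_toLin' S.A, ← charpoly_toLin' T.A, ← LinearEquiv.charpoly_conj H]
  congr 1
  refine LinearMap.ext fun y => ?_
  simpa [LinearEquiv.conj_apply] using hH.map_state (H.symm y)

theorem LinEquiv.eigenvaluesSatisfy_iff {S : ObsSystem ι p} {T : ObsSystem κ p} {P : ℂ → Prop}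
    (h : S.LinEquiv T) : S.EigenvaluesSatisfy P ↔ T.EigenvaluesSatisfy P := by
  rw [eigenvaluesSatisfy_iff_charpoly, eigenvaluesSatisfy_iff_charpoly, h.charpoly_eq]

theorem EigenvaluesSatisfy.isCoprime {S : ObsSystem ι p} {T : ObsSystem κ p} {P Q : ℂ → Prop}
    (hS : S.EigenvaluesSatisfy P) (hT : T.EigenvaluesSatisfy Q) (hPQ : ∀ z, P z → ¬ Q z) :
    IsCoprime S.A.charpoly T.A.charpoly := by
  rw [eigenvaluesSatisfy_iff_charpoly] at hS hT
  rw [Polynomial.isCoprime_iff_aeval_ne_zero_of_isAlgClosed ℝ ℂ]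
  intro z
  by_contra! h
  exact hPQ z (hS z h.1) (hT z h.2)

end Eigenvalues

section Observability

/-- The unobservable subspace `⋂ ker (C A^k)`: the states whose observation is identically zero. -/
def unobservable (S : ObsSystem ι p) : Submodule ℝ (ι → ℝ) :=
  ⨅ k : ℕ, LinearMap.ker (S.C * S.A ^ k).mulVecLin

theorem mem_unobservable {S : ObsSystem ι p} {x : ι → ℝ} :
    x ∈ S.unobservable ↔ ∀ k : ℕ, S.C *ᵥ (S.A ^ k *ᵥ x) = 0 := by
  simp [unobservable, Submodule.mem_iInf, mulVec_mulVec]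

theorem mulVec_eq_zero_of_mem_unobservable {S : ObsSystem ι p} {x : ι → ℝ}
    (hx : x ∈ S.unobservable) : S.C *ᵥ x = 0 := by
  simpa using mem_unobservable.1 hx 0

theorem pow_mulVec_mem_unobservable {S : ObsSystem ι p} {x : ι → ℝ} (hx : x ∈ S.unobservable)
    (k : ℕ) : S.A ^ k *ᵥ x ∈ S.unobservable := by
  rw [mem_unobservable] at hx ⊢
  intro j
  rw [mulVec_mulVec (M := S.A ^ j), ← pow_add]
  exact hx (j + k)

theorem aeval_mulVec_mem_unobservable {S : ObsSystem ι p} {x : ι → ℝ} (hx : x ∈ S.unobservable)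
    (q : Polynomial ℝ) : Polynomial.aeval S.A q *ᵥ x ∈ S.unobservable := by
  rw [Polynomial.aeval_eq_sum_range, sum_mulVec]
  refine Submodule.sum_mem _ fun k _ => ?_
  rw [smul_mulVec]
  exact Submodule.smul_mem _ _ (pow_mulVec_mem_unobservable hx k)

theorem ker_obsMatrix (S : ObsSystem ι p) :
    LinearMap.ker S.obsMatrix.mulVecLin = S.unobservable := by
  ext x
  have hker : S.obsMatrix *ᵥ x = 0 ↔ ∀ k < Fintype.card ι, S.C *ᵥ (S.A ^ k *ᵥ x) = 0 := by
    simp only [mulVec_mulVec, funext_iff, Prod.forall, Fin.forall_iff]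
    rfl
  rw [LinearMap.mem_ker, mulVecLin_apply, hker, mem_unobservable]
  refine ⟨fun h k => ?_, fun h k _ => h k⟩
  let outputAt : Matrix ι ι ℝ →ₗ[ℝ] (Fin p → ℝ) :=
    S.C.mulVecLin ∘ₗ (mulVecBilin ℝ ℝ).flip x
  have hle : Submodule.span ℝ ((S.A ^ ·) '' Set.Iio (Fintype.card ι)) ≤
      LinearMap.ker outputAt :=
    Submodule.span_le.2 (Set.forall_mem_image.2 fun j hj => h j hj)
  exact hle (pow_mem_span_pow_lt_card S.A k)

theorem kobs_add_finrank_unobservable (S : ObsSystem ι p) :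
    S.kobs + Module.finrank ℝ S.unobservable = Fintype.card ι := by
  rw [← ker_obsMatrix, kobs, Matrix.rank, LinearMap.finrank_range_add_finrank_ker,
    Module.finrank_fintype_fun_eq_card]

theorem kobs_le_card (S : ObsSystem ι p) : S.kobs ≤ Fintype.card ι :=
  S.obsMatrix.rank_le_card_width

theorem completelyObservable_iff {S : ObsSystem ι p} :
    S.CompletelyObservable ↔ S.unobservable = ⊥ := by
  have h := S.kobs_add_finrank_unobservable
  rw [CompletelyObservable, ← Submodule.finrank_eq_zero]
  lia

namespace Intertwines

variable {S : ObsSystem ι p} {T : ObsSystem κ p} {H : (ι → ℝ) →ₗ[ℝ] (κ → ℝ)}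

theorem mem_unobservable_iff (h : Intertwines S T H) {x : ι → ℝ} :
    H x ∈ T.unobservable ↔ x ∈ S.unobservable := by
  have hpow (k : ℕ) : T.A ^ k *ᵥ H x = H (S.A ^ k *ᵥ x) := by
    simpa using (map_aeval_mulVec h.map_state (Polynomial.X ^ k) x).symm
  simp only [mem_unobservable, hpow, h.output_map]

theorem ker_eq_unobservable (h : Intertwines S T H) (hT : T.CompletelyObservable) :
    LinearMap.ker H = S.unobservable := by
  ext x
  rw [← h.mem_unobservable_iff, completelyObservable_iff.1 hT, Submodule.mem_bot,
    LinearMap.mem_ker]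

end Intertwines

theorem LinEquiv.completelyObservable {S : ObsSystem ι p} {T : ObsSystem κ p} (h : S.LinEquiv T)
    (hS : S.CompletelyObservable) : T.CompletelyObservable := by
  obtain ⟨H, hH⟩ := linEquiv_iff.1 h.symm
  rw [completelyObservable_iff, ← hH.ker_eq_unobservable hS, LinearEquiv.ker]

theorem mem_unobservable_join {S : ObsSystem ι p} {T : ObsSystem κ p} {x : ι ⊕ κ → ℝ} :
    x ∈ (S.join T).unobservable ↔ ∀ k : ℕ,
      S.C *ᵥ (S.A ^ k *ᵥ (x ∘ Sum.inl)) + T.C *ᵥ (T.A ^ k *ᵥ (x ∘ Sum.inr)) = 0 := by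
  simp [mem_unobservable, ObsSystem.join, fromBlocks_diagonal_pow, fromBlocks_mulVec,
    fromCols_mulVec]

theorem sumElim_zero_mem_unobservable_join {S : ObsSystem ι p} {T : ObsSystem κ p} {u : ι → ℝ} :
    Sum.elim u 0 ∈ (S.join T).unobservable ↔ u ∈ S.unobservable := by
  rw [mem_unobservable_join, mem_unobservable]
  simp

theorem zero_sumElim_mem_unobservable_join {S : ObsSystem ι p} {T : ObsSystem κ p} {v : κ → ℝ} :
    Sum.elim (0 : ι → ℝ) v ∈ (S.join T).unobservable ↔ v ∈ T.unobservable := by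
  rw [mem_unobservable_join, mem_unobservable]
  simp

theorem aeval_join_mulVec (S : ObsSystem ι p) (T : ObsSystem κ p) (q : Polynomial ℝ)
    (x : ι ⊕ κ → ℝ) : Polynomial.aeval (S.join T).A q *ᵥ x =
      Sum.elim (Polynomial.aeval S.A q *ᵥ (x ∘ Sum.inl))
        (Polynomial.aeval T.A q *ᵥ (x ∘ Sum.inr)) := by
  have hinl := map_aeval_mulVec (A := (S.join T).A) (B := S.A)
    (H := LinearMap.funLeft ℝ ℝ Sum.inl)
    (fun x => by ext; simp [join, fromBlocks_mulVec, LinearMap.funLeft]) q x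
  have hinr := map_aeval_mulVec (A := (S.join T).A) (B := T.A)
    (H := LinearMap.funLeft ℝ ℝ Sum.inr)
    (fun x => by ext; simp [join, fromBlocks_mulVec, LinearMap.funLeft]) q x
  ext (i | i)
  · exact congr_fun hinl i
  · exact congr_fun hinr i

theorem CompletelyObservable.join {S : ObsSystem ι p} {T : ObsSystem κ p}
    (hS : S.CompletelyObservable) (hT : T.CompletelyObservable)
    (h : IsCoprime S.A.charpoly T.A.charpoly) : (S.join T).CompletelyObservable := by
  rw [completelyObservable_iff, Submodule.eq_bot_iff] at hS hT ⊢
  intro x hx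
  -- `χ_T(A) x` has no component in `T`, so it is an unobservable state of `S`.
  have hxT : Polynomial.aeval (S.join T).A T.A.charpoly *ᵥ x = 0 := by
    have hmem := aeval_mulVec_mem_unobservable hx T.A.charpoly
    rw [aeval_join_mulVec, aeval_self_charpoly, zero_mulVec] at hmem ⊢
    rw [hS _ (sumElim_zero_mem_unobservable_join.1 hmem), Sum.elim_zero_zero]
  have hxS : Polynomial.aeval (S.join T).A S.A.charpoly *ᵥ x = 0 := by
    have hmem := aeval_mulVec_mem_unobservable hx S.A.charpoly
    rw [aeval_join_mulVec, aeval_self_charpoly, zero_mulVec] at hmem ⊢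
    rw [hT _ (zero_sumElim_mem_unobservable_join.1 hmem), Sum.elim_zero_zero]
  obtain ⟨a, b, hab⟩ := h
  calc x = Polynomial.aeval (S.join T).A (a * S.A.charpoly + b * T.A.charpoly) *ᵥ x := by
        rw [hab, map_one, one_mulVec]
    _ = 0 := by
        rw [map_add, map_mul, map_mul, add_mulVec, ← mulVec_mulVec, ← mulVec_mulVec, hxS, hxT,
          mulVec_zero, mulVec_zero, add_zero]

end Observability

end ObsSystem

theorem exists_linearEquiv_funLeft_comp_eq {K V κ : Type*} [Field K] [AddCommGroup V] [Module K V]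
    [FiniteDimensional K V] {φ : V →ₗ[K] (κ → K)} (hφ : Function.Surjective φ) :
    ∃ (m : ℕ) (e : V ≃ₗ[K] (κ ⊕ Fin m → K)),
      LinearMap.funLeft K K Sum.inl ∘ₗ e.toLinearMap = φ := by
  obtain ⟨W, hW⟩ := (LinearMap.ker φ).exists_isCompl
  let eKer : LinearMap.ker φ ≃ₗ[K] (Fin (Module.finrank K (LinearMap.ker φ)) → K) :=
    LinearEquiv.ofFinrankEq _ _ (by simp)
  let split : V ≃ₗ[K] (κ → K) × LinearMap.ker φ :=
    LinearMap.equivProdOfSurjectiveOfIsCompl φ ((LinearMap.ker φ).projectionOnto W hW)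
      (LinearMap.range_eq_top.2 hφ) (Submodule.range_projectionOnto hW) (by simpa using hW)
  exact ⟨_, split.trans (((LinearEquiv.refl K (κ → K)).prodCongr eKer).trans
    (LinearEquiv.sumArrowLequivProdArrow _ _ K K).symm), rfl⟩

namespace ObsSystem

section ObservablePart

variable {ι κ ι' κ' : Type*} {p : ℕ}
variable [Fintype ι] [Fintype κ] [Fintype ι'] [Fintype κ'] [DecidableEq κ]

theorem isObservablePart_iff {S : ObsSystem ι p} {T : ObsSystem κ p} :
    S.IsObservablePart T ↔ T.CompletelyObservable ∧
      ∃ φ : (ι → ℝ) →ₗ[ℝ] (κ → ℝ), Function.Surjective φ ∧ Intertwines S T φ := by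
  refine and_congr_right fun _ => ⟨?_, ?_⟩
  · rintro ⟨m, L, U, hS⟩
    obtain ⟨H, hH⟩ := linEquiv_iff.1 hS
    exact ⟨_, (LinearMap.funLeft_surjective_of_injective ℝ ℝ Sum.inl Sum.inl_injective).comp
      H.surjective, (intertwines_extend T L U).comp hH⟩
  · rintro ⟨φ, hφsurj, hφ⟩
    obtain ⟨m, e, rfl⟩ := exists_linearEquiv_funLeft_comp_eq hφsurj
    classical
    let R := ofLinear S.A.mulVecLin S.C.mulVecLin e
    have hSR : Intertwines S R e.toLinearMap :=
      ⟨fun x => (ofLinear_A_mulVec S.A.mulVecLin _ e x).symm, ofLinear_C_mulVec _ _ e⟩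
    have hRT : Intertwines R T (LinearMap.funLeft ℝ ℝ Sum.inl) := .of_comp hφ hSR e.surjective
    have hR : S.LinEquiv (T.extend R.A.toBlocks₂₁ R.A.toBlocks₂₂) := by
      rw [← eq_extend_of_intertwines hRT]
      exact linEquiv_iff.2 ⟨e, hSR⟩
    exact ⟨m, _, _, hR⟩

theorem exists_isObservablePart [DecidableEq ι] (S : ObsSystem ι p) :
    ∃ T : ObsSystem (Fin S.kobs) p, S.IsObservablePart T := by
  let V := (ι → ℝ) ⧸ S.unobservable
  have hV : Module.finrank ℝ V = Module.finrank ℝ (Fin S.kobs → ℝ) := by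
    have h₁ := S.unobservable.finrank_quotient_add_finrank
    have h₂ := S.kobs_add_finrank_unobservable
    rw [Module.finrank_fintype_fun_eq_card] at h₁
    rw [Module.finrank_fin_fun]
    lia
  let e : V ≃ₗ[ℝ] (Fin S.kobs → ℝ) := LinearEquiv.ofFinrankEq _ _ hV
  let f : V →ₗ[ℝ] V := S.unobservable.mapQ S.unobservable S.A.mulVecLin fun x hx => by
    simpa using pow_mulVec_mem_unobservable hx 1
  let g : V →ₗ[ℝ] (Fin p → ℝ) := S.unobservable.liftQ S.C.mulVecLin fun x hx =>
    mulVec_eq_zero_of_mem_unobservable hx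
  let φ : (ι → ℝ) →ₗ[ℝ] (Fin S.kobs → ℝ) := e.toLinearMap ∘ₗ S.unobservable.mkQ
  have hφsurj : Function.Surjective φ := e.surjective.comp S.unobservable.mkQ_surjective
  have hφ : Intertwines S (ofLinear f g e) φ :=
    ⟨fun x => (ofLinear_A_mulVec f g e (S.unobservable.mkQ x)).symm,
      fun x => ofLinear_C_mulVec f g e (S.unobservable.mkQ x)⟩
  refine ⟨_, isObservablePart_iff.2 ⟨?_, φ, hφsurj, hφ⟩⟩
  rw [completelyObservable_iff, Submodule.eq_bot_iff, hφsurj.forall]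
  intro x hx
  have hx' : S.unobservable.mkQ x = 0 := by
    rwa [hφ.mem_unobservable_iff, ← S.unobservable.ker_mkQ] at hx
  simp [φ, hx']

theorem IsObservablePart.trans_linEquiv [DecidableEq κ'] {S : ObsSystem ι p} {T : ObsSystem κ p}
    {T' : ObsSystem κ' p} (h : S.IsObservablePart T) (hT : T.LinEquiv T') :
    S.IsObservablePart T' := by
  obtain ⟨hobs, φ, hφsurj, hφ⟩ := isObservablePart_iff.1 h
  obtain ⟨H, hH⟩ := linEquiv_iff.1 hT
  exact isObservablePart_iff.2 ⟨hT.completelyObservable hobs, _, H.surjective.comp hφsurj,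
    hH.comp hφ⟩

theorem IsObservablePart.linEquiv [DecidableEq κ'] {S : ObsSystem ι p} {T : ObsSystem κ p}
    {T' : ObsSystem κ' p} (h : S.IsObservablePart T) (h' : S.IsObservablePart T') :
    T.LinEquiv T' := by
  obtain ⟨hT, φ, hφsurj, hφ⟩ := isObservablePart_iff.1 h
  obtain ⟨hT', φ', hφ'surj, hφ'⟩ := isObservablePart_iff.1 h'
  classical
  have hker : LinearMap.ker φ = LinearMap.ker φ' := by
    rw [hφ.ker_eq_unobservable hT, hφ'.ker_eq_unobservable hT']
  let G : (κ → ℝ) ≃ₗ[ℝ] (κ' → ℝ) := (φ.quotKerEquivOfSurjective hφsurj).symm.trans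
    ((Submodule.quotEquivOfEq _ _ hker).trans (φ'.quotKerEquivOfSurjective hφ'surj))
  have hG : G.toLinearMap ∘ₗ φ = φ' := by
    refine LinearMap.ext fun x => ?_
    simp [G]
  exact linEquiv_iff.2 ⟨G, .of_comp (hG ▸ hφ') hφ hφsurj⟩

theorem IsObservablePart.join [DecidableEq κ'] {S : ObsSystem ι p} {S' : ObsSystem κ p}
    {T : ObsSystem ι' p} {T' : ObsSystem κ' p} (hS : S.IsObservablePart S')
    (hT : T.IsObservablePart T') (h : IsCoprime S'.A.charpoly T'.A.charpoly) :
    (S.join T).IsObservablePart (S'.join T') := by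
  obtain ⟨hS', φ, hφsurj, hφ⟩ := isObservablePart_iff.1 hS
  obtain ⟨hT', ψ, hψsurj, hψ⟩ := isObservablePart_iff.1 hT
  refine isObservablePart_iff.2 ⟨hS'.join hT' h, _, ?_, hφ.join hψ⟩
  exact (LinearEquiv.sumArrowLequivProdArrow κ κ' ℝ ℝ).symm.surjective.comp
    ((hφsurj.prodMap hψsurj).comp (LinearEquiv.sumArrowLequivProdArrow ι ι' ℝ ℝ).surjective)

theorem IsObservablePart.eigenvaluesSatisfy [DecidableEq ι] {S : ObsSystem ι p} {T : ObsSystem κ p}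
    {P : ℂ → Prop} (h : S.IsObservablePart T) (hS : S.EigenvaluesSatisfy P) :
    T.EigenvaluesSatisfy P := by
  obtain ⟨-, m, L, U, hlin⟩ := h
  exact (eigenvaluesSatisfy_extend.1 (hlin.eigenvaluesSatisfy_iff.1 hS)).1

end ObservablePart

end ObsSystem

section RealPolynomials

open Polynomial
open scoped ComplexConjugate

theorem eq_or_eq_conj_of_irreducible {q : ℝ[X]} (hq : Irreducible q) {z w : ℂ}
    (hz : aeval z q = 0) (hw : aeval w q = 0) : w = z ∨ w = conj z := by
  have hconj : IsConjRoot ℝ z w := by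
    rw [isConjRoot_def, ← minpoly.eq_of_irreducible hq hz, minpoly.eq_of_irreducible hq hw]
  have : IsAlgClosure ℝ ℂ := ⟨inferInstance, inferInstance⟩
  have := IsAlgClosure.normal ℝ ℂ
  obtain ⟨σ, rfl⟩ := hconj.symm.exists_algEquiv
  obtain hσ | hσ := Complex.real_algHom_eq_id_or_conj σ.toAlgHom
  · exact .inl (DFunLike.congr_fun hσ z)
  · exact .inr (DFunLike.congr_fun hσ z)

theorem exists_eq_mul_of_conj_invariant {P : ℂ → Prop} (hP : ∀ z, P z → P (conj z)) {q : ℝ[X]}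
    (hq : q ≠ 0) : ∃ a b : ℝ[X], q = a * b ∧ (∀ z : ℂ, aeval z a = 0 → P z) ∧
      ∀ z : ℂ, aeval z b = 0 → ¬P z := by
  induction q using WfDvdMonoid.induction_on_irreducible with
  | zero => exact absurd rfl hq
  | unit u hu => exact ⟨u, 1, by simp, fun z hz => absurd hz (hu.map (aeval z)).ne_zero, by simp⟩
  | mul q i hq' hi ih =>
    obtain ⟨a, b, rfl, ha, hb⟩ := ih hq'
    obtain ⟨z₀, hz₀⟩ : ∃ z : ℂ, aeval z i = 0 :=
      IsAlgClosed.exists_aeval_eq_zero ℂ i (degree_pos_of_irreducible hi).ne'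
    have hroots : ∀ z : ℂ, aeval z i = 0 → (P z ↔ P z₀) := fun z hz => by
      obtain rfl | rfl := eq_or_eq_conj_of_irreducible hi hz₀ hz
      · rfl
      · exact ⟨fun h => by simpa using hP _ h, hP _⟩
    by_cases h₀ : P z₀
    · refine ⟨i * a, b, (mul_assoc i a b).symm, fun z hz => ?_, hb⟩
      rw [map_mul, mul_eq_zero] at hz
      exact hz.elim (fun hzi => (hroots z hzi).2 h₀) (ha z)
    · refine ⟨a, i * b, mul_left_comm i a b, ha, fun z hz => ?_⟩
      rw [map_mul, mul_eq_zero] at hz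
      exact hz.elim (fun hzi => (hroots z hzi).not.2 h₀) (hb z)

end RealPolynomials

namespace ObsSystem

section Spectral

open scoped ComplexConjugate

variable {ι κ : Type*} {p : ℕ} [Fintype ι]

theorem exists_intertwines_range_eq (S : ObsSystem ι p) {V : Submodule ℝ (ι → ℝ)}
    (hV : ∀ x ∈ V, S.A *ᵥ x ∈ V) :
    ∃ (n : ℕ) (R : ObsSystem (Fin n) p) (e : (Fin n → ℝ) ≃ₗ[ℝ] V),
      Intertwines R S (V.subtype ∘ₗ e.toLinearMap) := by
  let e : V ≃ₗ[ℝ] (Fin (Module.finrank ℝ V) → ℝ) := LinearEquiv.ofFinrankEq _ _ (by simp)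
  let f : V →ₗ[ℝ] V := S.A.mulVecLin.restrict hV
  let g : V →ₗ[ℝ] (Fin p → ℝ) := S.C.mulVecLin ∘ₗ V.subtype
  refine ⟨_, ofLinear f g e, e.symm, e.surjective.forall.2 fun v => ?_,
    e.surjective.forall.2 fun v => ?_⟩
  · simp only [ofLinear_A_mulVec, LinearMap.comp_apply, LinearEquiv.coe_coe,
      LinearEquiv.symm_apply_apply]
    rfl
  · simp [ofLinear_C_mulVec, g]

theorem eigenvaluesSatisfy_of_aeval_eq_zero [DecidableEq ι] {S : ObsSystem ι p}
    {q : Polynomial ℝ} {P : ℂ → Prop}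
    (hS : Polynomial.aeval S.A q = 0) (hq : ∀ z : ℂ, Polynomial.aeval z q = 0 → P z) :
    S.EigenvaluesSatisfy P := by
  intro z hz
  refine hq z ?_
  have : Nontrivial (Matrix ι ι ℂ) := by
    by_contra h
    rw [not_nontrivial_iff_subsingleton] at h
    simp [spectrum.of_subsingleton] at hz
  have hannihilated :
      Polynomial.aeval (S.A.map (algebraMap ℝ ℂ)) (q.map (algebraMap ℝ ℂ)) = 0 := by
    rw [Polynomial.aeval_map_algebraMap]
    refine (Polynomial.aeval_algHom_apply (Algebra.ofId ℝ ℂ).mapMatrix S.A q).trans ?_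
    rw [hS, map_zero]
  have hroot := spectrum.subset_polynomial_aeval (S.A.map (algebraMap ℝ ℂ))
    (q.map (algebraMap ℝ ℂ)) ⟨z, hz, rfl⟩
  rw [hannihilated, spectrum.zero_eq, Set.mem_singleton_iff] at hroot
  simpa [Polynomial.eval_map_algebraMap] using hroot

theorem exists_intertwines_ker_aeval [DecidableEq ι] (S : ObsSystem ι p) (q : Polynomial ℝ) :
    ∃ (n : ℕ) (R : ObsSystem (Fin n) p)
      (e : (Fin n → ℝ) ≃ₗ[ℝ] LinearMap.ker (Polynomial.aeval S.A q).mulVecLin),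
      Intertwines R S (Submodule.subtype _ ∘ₗ e.toLinearMap) ∧ Polynomial.aeval R.A q = 0 := by
  have hcomm : Polynomial.aeval S.A q * S.A = S.A * Polynomial.aeval S.A q := by
    simpa using congrArg (Polynomial.aeval S.A) (mul_comm q Polynomial.X)
  obtain ⟨n, R, e, he⟩ := S.exists_intertwines_range_eq
    (V := LinearMap.ker (Polynomial.aeval S.A q).mulVecLin) fun x hx => by
      rw [LinearMap.mem_ker, mulVecLin_apply] at hx ⊢
      rw [mulVec_mulVec, hcomm, ← mulVec_mulVec, hx, mulVec_zero]
  refine ⟨n, R, e, he, mulVec_injective <| funext fun x => e.injective <| Subtype.ext ?_⟩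
  have hx : Polynomial.aeval S.A q *ᵥ (e x : ι → ℝ) = 0 := (e x).2
  simpa [hx] using map_aeval_mulVec he.map_state q x

theorem exists_linEquiv_join_of_isCoprime [DecidableEq ι] (S : ObsSystem ι p) {a b : Polynomial ℝ}
    (hab : IsCoprime a b) (h : Polynomial.aeval S.A (a * b) = 0) :
    ∃ (k m : ℕ) (S₁ : ObsSystem (Fin k) p) (S₂ : ObsSystem (Fin m) p),
      Polynomial.aeval S₁.A a = 0 ∧ Polynomial.aeval S₂.A b = 0 ∧ S.LinEquiv (S₁.join S₂) := by
  have haeval (q : Polynomial ℝ) : Polynomial.aeval S.A.mulVecLin q =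
      (Polynomial.aeval S.A q).mulVecLin :=
    Polynomial.aeval_algHom_apply (toLinAlgEquiv' : Matrix ι ι ℝ ≃ₐ[ℝ] _) S.A q
  have hcompl : IsCompl (LinearMap.ker (Polynomial.aeval S.A a).mulVecLin)
      (LinearMap.ker (Polynomial.aeval S.A b).mulVecLin) := by
    rw [← haeval, ← haeval]
    refine ⟨Polynomial.disjoint_ker_aeval_of_isCoprime _ hab, ?_⟩
    rw [codisjoint_iff, Polynomial.sup_ker_aeval_eq_ker_aeval_mul_of_coprime _ hab, haeval, h]
    simp
  obtain ⟨k, S₁, e₁, he₁, h₁⟩ := S.exists_intertwines_ker_aeval a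
  obtain ⟨m, S₂, e₂, he₂, h₂⟩ := S.exists_intertwines_ker_aeval b
  exact ⟨k, m, S₁, S₂, h₁, h₂, .symm <| linEquiv_iff.2
    ⟨(LinearEquiv.sumArrowLequivProdArrow _ _ ℝ ℝ).trans
      ((e₁.prodCongr e₂).trans (Submodule.prodEquivOfIsCompl _ _ hcompl)), he₁.coprod he₂⟩⟩

theorem exists_linEquiv_join_of_conj_invariant (S : ObsSystem ι p) {P : ℂ → Prop}
    (hP : ∀ z, P z → P (conj z)) :
    ∃ (k m : ℕ) (S₁ : ObsSystem (Fin k) p) (S₂ : ObsSystem (Fin m) p),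
      S₁.EigenvaluesSatisfy P ∧ S₂.EigenvaluesSatisfy (fun z => ¬P z) ∧
        S.LinEquiv (S₁.join S₂) := by
  classical
  obtain ⟨a, b, hab, ha, hb⟩ := exists_eq_mul_of_conj_invariant hP S.A.charpoly_monic.ne_zero
  have hcoprime : IsCoprime a b := by
    rw [Polynomial.isCoprime_iff_aeval_ne_zero_of_isAlgClosed ℝ ℂ]
    intro z
    by_contra! h
    exact hb z h.2 (ha z h.1)
  obtain ⟨k, m, S₁, S₂, h₁, h₂, hS⟩ := S.exists_linEquiv_join_of_isCoprime hcoprime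
    (by rw [← hab, aeval_self_charpoly])
  exact ⟨k, m, S₁, S₂, eigenvaluesSatisfy_of_aeval_eq_zero h₁ ha,
    eigenvaluesSatisfy_of_aeval_eq_zero h₂ hb, hS⟩

theorem nonempty_spectralDecomposition (S : ObsSystem ι p) :
    Nonempty S.SpectralDecomposition := by
  obtain ⟨k, m, S₀, T, h₀, hT, hS⟩ :=
    S.exists_linEquiv_join_of_conj_invariant (P := fun z => z.re = 0) (by simp)
  obtain ⟨k', m', S₁, S₂, h₁, h₂, hT'⟩ :=
    T.exists_linEquiv_join_of_conj_invariant (P := fun z => 0 < z.re) (by simp)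
  have hne : S₂.EigenvaluesSatisfy fun z => z.re ≠ 0 :=
    (eigenvaluesSatisfy_join.1 (hT'.eigenvaluesSatisfy_iff.1 hT)).2
  exact ⟨⟨k, k', m', S₀, S₁, S₂, h₀, h₁, fun z hz => lt_of_le_of_ne (not_lt.1 (h₂ z hz)) (hne z hz),
    hS.trans ((LinEquiv.refl S₀).join hT')⟩⟩

end Spectral

end ObsSystem

section ExpandingFlows

open Filter Topology

variable {E : Type*} [NormedAddCommGroup E] [InnerProductSpace ℝ E]

/-- The linear vector field `A` is expanding: the squared norm grows at least at an exponential rate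
along its flow. This is stated infinitesimally, in terms of the radial component of `A`. -/
def IsExpanding (A : E →L[ℝ] E) : Prop :=
  ∃ c > 0, ∀ x, c * ‖x‖ ^ 2 ≤ inner ℝ x (A x)

/-- The time at which the orbit of `x` under the flow of `A` crosses the unit sphere. The value is
meaningful for `x ≠ 0` and expanding `A`, where this time is unique. -/
noncomputable def crossingTime (A : E →L[ℝ] E) (x : E) : ℝ :=
  Classical.epsilon fun t => ‖linearFlow A t x‖ = 1

open Classical in
/-- The map that fixes the unit sphere pointwise and carries the orbits of `A` to those of `B`,
respecting time: follow `A` to the unit sphere, then `B` backwards for the same time. -/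
noncomputable def orbitMap (A B : E →L[ℝ] E) (x : E) : E :=
  if x = 0 then 0 else linearFlow B (-crossingTime A x) (linearFlow A (crossingTime A x) x)

@[simp]
theorem orbitMap_zero (A B : E →L[ℝ] E) : orbitMap A B 0 = 0 := if_pos rfl

theorem orbitMap_of_ne_zero (A B : E →L[ℝ] E) {x : E} (hx : x ≠ 0) :
    orbitMap A B x = linearFlow B (-crossingTime A x) (linearFlow A (crossingTime A x) x) :=
  if_neg hx

theorem IsExpanding.eventually_nhds {A : E →L[ℝ] E} (hA : IsExpanding A) :
    ∀ᶠ B in 𝓝 A, IsExpanding B := by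
  obtain ⟨c, hc, hAc⟩ := hA
  filter_upwards [Metric.ball_mem_nhds A (half_pos hc)] with B hB
  refine ⟨c / 2, half_pos hc, fun x => ?_⟩
  have hpert : -(c / 2 * ‖x‖ ^ 2) ≤ inner ℝ x ((B - A) x) := by
    refine neg_le_of_abs_le ((abs_real_inner_le_norm _ _).trans ?_)
    calc ‖x‖ * ‖(B - A) x‖ ≤ ‖x‖ * (c / 2 * ‖x‖) := by
          gcongr
          exact (B - A).le_of_opNorm_le (mem_ball_iff_norm.1 hB).le x
      _ = c / 2 * ‖x‖ ^ 2 := by ring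
  have hsplit : inner ℝ x (B x) = inner ℝ x (A x) + inner ℝ x ((B - A) x) := by
    rw [← inner_add_right, _root_.sub_apply, add_sub_cancel]
  linarith [hAc x]

variable [CompleteSpace E]

theorem orbitMap_ne_zero (A B : E →L[ℝ] E) {x : E} (hx : x ≠ 0) : orbitMap A B x ≠ 0 := by
  rw [orbitMap_of_ne_zero A B hx]
  exact linearFlow_ne_zero _ _ (linearFlow_ne_zero _ _ hx)

theorem map_orbitMap {F : Type*} [NormedAddCommGroup F] [NormedSpace ℝ F] [CompleteSpace F]
    {A B : E →L[ℝ] E} {P : E →L[ℝ] F} {D : F →L[ℝ] F} (hA : ∀ x, P (A x) = D (P x))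
    (hB : ∀ x, P (B x) = D (P x)) (x : E) : P (orbitMap A B x) = P x := by
  by_cases hx : x = 0
  · simp [hx]
  · rw [orbitMap_of_ne_zero A B hx, map_linearFlow hB, map_linearFlow hA,
      linearFlow_neg_apply_self]

theorem hasDerivAt_norm_sq_linearFlow (A : E →L[ℝ] E) (x : E) (t : ℝ) :
    HasDerivAt (fun s => ‖linearFlow A s x‖ ^ 2)
      (2 * inner ℝ (linearFlow A t x) (A (linearFlow A t x))) t :=
  (hasDerivAt_linearFlow A x t).norm_sq

namespace IsExpanding

variable {A B : E →L[ℝ] E}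

theorem exists_exp_mul_norm_le (hA : IsExpanding A) :
    ∃ c > 0, ∀ x, ∀ t ≥ 0, Real.exp (c * t) * ‖x‖ ≤ ‖linearFlow A t x‖ := by
  obtain ⟨c, hc, hAc⟩ := hA
  refine ⟨c, hc, fun x t ht => ?_⟩
  have hderiv (s : ℝ) :
      HasDerivAt (fun s => Real.exp (-(2 * c) * s) * ‖linearFlow A s x‖ ^ 2)
        (2 * Real.exp (-(2 * c) * s) * (inner ℝ (linearFlow A s x) (A (linearFlow A s x)) -
          c * ‖linearFlow A s x‖ ^ 2)) s := by
    have hexp : HasDerivAt (fun s => Real.exp (-(2 * c) * s))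
        (Real.exp (-(2 * c) * s) * -(2 * c)) s := by
      simpa using ((hasDerivAt_id s).const_mul (-(2 * c))).exp
    exact (hexp.mul (hasDerivAt_norm_sq_linearFlow A x s)).congr_deriv (by ring)
  have hmono : Monotone fun s => Real.exp (-(2 * c) * s) * ‖linearFlow A s x‖ ^ 2 :=
    monotone_of_hasDerivAt_nonneg hderiv fun s =>
      mul_nonneg (by positivity) (sub_nonneg.2 (hAc (linearFlow A s x)))
  have hsq : ‖x‖ ^ 2 ≤ Real.exp (-(2 * c) * t) * ‖linearFlow A t x‖ ^ 2 := by
    simpa using hmono ht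
  refine le_of_sq_le_sq ?_ (norm_nonneg _)
  calc (Real.exp (c * t) * ‖x‖) ^ 2 = Real.exp (2 * (c * t)) * ‖x‖ ^ 2 := by
        rw [mul_pow, ← Real.exp_nat_mul, Nat.cast_ofNat]
    _ ≤ Real.exp (2 * (c * t)) * (Real.exp (-(2 * c) * t) * ‖linearFlow A t x‖ ^ 2) := by
        gcongr
    _ = ‖linearFlow A t x‖ ^ 2 := by
        rw [← mul_assoc, ← Real.exp_add]
        ring_nf
        simp

theorem strictMono_norm_linearFlow (hA : IsExpanding A) {x : E} (hx : x ≠ 0) :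
    StrictMono fun t => ‖linearFlow A t x‖ := by
  obtain ⟨c, hc, hgrowth⟩ := hA.exists_exp_mul_norm_le
  intro s t hst
  calc ‖linearFlow A s x‖ < Real.exp (c * (t - s)) * ‖linearFlow A s x‖ :=
        lt_mul_of_one_lt_left (norm_pos_iff.2 (linearFlow_ne_zero A s hx))
          (Real.one_lt_exp_iff.2 (mul_pos hc (sub_pos.2 hst)))
    _ ≤ ‖linearFlow A (t - s) (linearFlow A s x)‖ := hgrowth _ _ (sub_nonneg.2 hst.le)
    _ = ‖linearFlow A t x‖ := by rw [← linearFlow_add, sub_add_cancel]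

theorem tendsto_norm_linearFlow_atTop (hA : IsExpanding A) {x : E} (hx : x ≠ 0) :
    Tendsto (fun t => ‖linearFlow A t x‖) atTop atTop := by
  obtain ⟨c, hc, hgrowth⟩ := hA.exists_exp_mul_norm_le
  have hexp : Tendsto (fun t => Real.exp (c * t) * ‖x‖) atTop atTop :=
    (Real.tendsto_exp_atTop.comp (tendsto_id.const_mul_atTop hc)).atTop_mul_const
      (norm_pos_iff.2 hx)
  exact tendsto_atTop_mono' _ (by
    filter_upwards [eventually_ge_atTop 0] with t ht using hgrowth x t ht) hexp

theorem tendsto_norm_linearFlow_atBot (hA : IsExpanding A) (x : E) :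
    Tendsto (fun t => ‖linearFlow A t x‖) atBot (𝓝 0) := by
  obtain ⟨c, hc, hgrowth⟩ := hA.exists_exp_mul_norm_le
  have hexp : Tendsto (fun t => Real.exp (c * t) * ‖x‖) atBot (𝓝 0) := by
    simpa using (Real.tendsto_exp_atBot.comp (tendsto_id.const_mul_atBot hc)).mul_const ‖x‖
  refine squeeze_zero' (.of_forall fun t => norm_nonneg _) ?_ hexp
  filter_upwards [eventually_le_atBot 0] with t ht
  have h := hgrowth (linearFlow A t x) (-t) (neg_nonneg.2 ht)
  rw [linearFlow_neg_apply_self] at h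
  calc ‖linearFlow A t x‖
      = Real.exp (c * t) * (Real.exp (c * -t) * ‖linearFlow A t x‖) := by
        rw [← mul_assoc, ← Real.exp_add, mul_neg, add_neg_cancel, Real.exp_zero, one_mul]
    _ ≤ Real.exp (c * t) * ‖x‖ := by gcongr

theorem norm_linearFlow_crossingTime (hA : IsExpanding A) {x : E} (hx : x ≠ 0) :
    ‖linearFlow A (crossingTime A x) x‖ = 1 := by
  have hcont : Continuous fun t => ‖linearFlow A t x‖ :=
    ((continuous_linearFlow A).comp (Continuous.prodMk_left x)).norm
  obtain ⟨s, hs⟩ :=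
    ((hA.tendsto_norm_linearFlow_atBot x).eventually_le_const zero_lt_one).exists
  obtain ⟨t, ht⟩ := ((hA.tendsto_norm_linearFlow_atTop hx).eventually_ge_atTop 1).exists
  exact Classical.epsilon_spec (mem_range_of_exists_le_of_exists_ge hcont ⟨s, hs⟩ ⟨t, ht⟩)

theorem crossingTime_eq (hA : IsExpanding A) {x : E} (hx : x ≠ 0) {t : ℝ}
    (ht : ‖linearFlow A t x‖ = 1) : crossingTime A x = t :=
  (hA.strictMono_norm_linearFlow hx).injective ((hA.norm_linearFlow_crossingTime hx).trans ht.symm)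

theorem lt_crossingTime_iff (hA : IsExpanding A) {x : E} (hx : x ≠ 0) {t : ℝ} :
    t < crossingTime A x ↔ ‖linearFlow A t x‖ < 1 := by
  rw [← hA.norm_linearFlow_crossingTime hx]
  exact (hA.strictMono_norm_linearFlow hx).lt_iff_lt.symm

theorem crossingTime_lt_iff (hA : IsExpanding A) {x : E} (hx : x ≠ 0) {t : ℝ} :
    crossingTime A x < t ↔ 1 < ‖linearFlow A t x‖ := by
  rw [← hA.norm_linearFlow_crossingTime hx]
  exact (hA.strictMono_norm_linearFlow hx).lt_iff_lt.symm

theorem crossingTime_linearFlow (hA : IsExpanding A) {x : E} (hx : x ≠ 0) (t : ℝ) :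
    crossingTime A (linearFlow A t x) = crossingTime A x - t :=
  hA.crossingTime_eq (linearFlow_ne_zero A t hx) <| by
    rw [← linearFlow_add, sub_add_cancel, hA.norm_linearFlow_crossingTime hx]

theorem continuousAt_crossingTime (hA : IsExpanding A) {x : E} (hx : x ≠ 0) :
    ContinuousAt (crossingTime A) x := by
  have hne : ∀ᶠ y in 𝓝 x, y ≠ 0 := isOpen_ne.mem_nhds hx
  have hcont (t : ℝ) : ContinuousAt (fun y => ‖linearFlow A t y‖) x := by fun_prop
  refine tendsto_order.2 ⟨fun t ht => ?_, fun t ht => ?_⟩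
  · filter_upwards [hne, (hcont t).eventually_lt_const ((hA.lt_crossingTime_iff hx).1 ht)]
      with y hy h using (hA.lt_crossingTime_iff hy).2 h
  · filter_upwards [hne, (hcont t).eventually_const_lt ((hA.crossingTime_lt_iff hx).1 ht)]
      with y hy h using (hA.crossingTime_lt_iff hy).2 h

theorem tendsto_crossingTime_atTop (hA : IsExpanding A) :
    Tendsto (crossingTime A) (𝓝[≠] 0) atTop := by
  refine tendsto_atTop.2 fun t => ?_
  have hcont : ContinuousAt (fun y => ‖linearFlow A t y‖) 0 := by fun_prop
  filter_upwards [self_mem_nhdsWithin,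
    (hcont.eventually_lt_const (u := 1) (by simp)).filter_mono nhdsWithin_le_nhds]
    with y hy h using ((hA.lt_crossingTime_iff hy).2 h).le

theorem orbitMap_linearFlow (hA : IsExpanding A) (t : ℝ) (x : E) :
    orbitMap A B (linearFlow A t x) = linearFlow B t (orbitMap A B x) := by
  by_cases hx : x = 0
  · simp [hx]
  · rw [orbitMap_of_ne_zero A B (linearFlow_ne_zero A t hx), orbitMap_of_ne_zero A B hx,
      hA.crossingTime_linearFlow hx, ← linearFlow_add, ← linearFlow_add, sub_add_cancel,
      neg_sub, sub_eq_add_neg]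

theorem orbitMap_orbitMap (hA : IsExpanding A) (hB : IsExpanding B) (x : E) :
    orbitMap B A (orbitMap A B x) = x := by
  by_cases hx : x = 0
  · simp [hx]
  · have htime : crossingTime B (orbitMap A B x) = crossingTime A x :=
      hB.crossingTime_eq (orbitMap_ne_zero A B hx) <| by
        rw [orbitMap_of_ne_zero A B hx, linearFlow_apply_neg_self,
          hA.norm_linearFlow_crossingTime hx]
    rw [orbitMap_of_ne_zero B A (orbitMap_ne_zero A B hx), htime, orbitMap_of_ne_zero A B hx,
      linearFlow_apply_neg_self, linearFlow_neg_apply_self]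

theorem continuousAt_orbitMap_zero (hA : IsExpanding A) (hB : IsExpanding B) :
    ContinuousAt (orbitMap A B) 0 := by
  obtain ⟨c, hc, hgrowth⟩ := hB.exists_exp_mul_norm_le
  rw [continuousAt_iff_punctured_nhds, orbitMap_zero]
  have hexp : Tendsto (fun x => Real.exp (-(c * crossingTime A x))) (𝓝[≠] 0) (𝓝 0) :=
    Real.tendsto_exp_neg_atTop_nhds_zero.comp
      (hA.tendsto_crossingTime_atTop.const_mul_atTop hc)
  refine squeeze_zero_norm' ?_ hexp
  filter_upwards [self_mem_nhdsWithin, hA.tendsto_crossingTime_atTop.eventually_ge_atTop 0]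
    with x hx ht
  have h := hgrowth (orbitMap A B x) _ ht
  rw [orbitMap_of_ne_zero A B hx, linearFlow_apply_neg_self,
    hA.norm_linearFlow_crossingTime hx, ← orbitMap_of_ne_zero A B hx] at h
  rwa [Real.exp_neg, ← one_div, le_div_iff₀' (Real.exp_pos _)]

theorem continuous_orbitMap (hA : IsExpanding A) (hB : IsExpanding B) :
    Continuous (orbitMap A B) := by
  refine continuous_iff_continuousAt.2 fun x => ?_
  by_cases hx : x = 0
  · exact hx ▸ hA.continuousAt_orbitMap_zero hB
  · have htime := hA.continuousAt_crossingTime hx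
    have hcont : ContinuousAt
        (fun y => linearFlow B (-crossingTime A y) (linearFlow A (crossingTime A y) y)) x :=
      (continuous_linearFlow B).continuousAt.comp (htime.neg.prodMk
        ((continuous_linearFlow A).continuousAt.comp (htime.prodMk continuousAt_id)))
    refine hcont.congr ?_
    filter_upwards [isOpen_ne.mem_nhds hx] with y hy using (orbitMap_of_ne_zero A B hy).symm

/-- The orbit-matching map of two expanding fields as a homeomorphism. -/
noncomputable def orbitHomeomorph (hA : IsExpanding A) (hB : IsExpanding B) : E ≃ₜ E where
  toFun := orbitMap A B
  invFun := orbitMap B A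
  left_inv := hA.orbitMap_orbitMap hB
  right_inv := hB.orbitMap_orbitMap hA
  continuous_toFun := hA.continuous_orbitMap hB
  continuous_invFun := hB.continuous_orbitMap hA

end IsExpanding

end ExpandingFlows

section LyapunovNorm

open scoped Pointwise

theorem exists_forall_norm_lt_one_of_spectrum_re_pos {𝔸 : Type*} [NormedRing 𝔸] [NormedAlgebra ℂ 𝔸]
    [CompleteSpace 𝔸] {a : 𝔸} (ha : ∀ z ∈ spectrum ℂ a, 0 < z.re) :
    ∃ ε : ℝ, 0 < ε ∧ ∀ z ∈ spectrum ℂ (1 - (ε : ℂ) • a), ‖z‖ < 1 := by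
  have hne : ∀ z ∈ spectrum ℂ a, z ≠ 0 := by
    rintro z hz rfl
    simpa using ha 0 hz
  obtain ⟨ε, hε, hεle⟩ := (spectrum.isCompact (𝕜 := ℂ) a).exists_forall_le'
    (f := fun z => z.re / ‖z‖ ^ 2) (a := 0)
    (Complex.continuous_re.continuousOn.div (continuous_norm.pow 2).continuousOn
      fun z hz => pow_ne_zero 2 (norm_ne_zero_iff.2 (hne z hz)))
    fun z hz => div_pos (ha z hz) (pow_pos (norm_pos_iff.2 (hne z hz)) 2)
  have hε' : (ε : ℂ) ≠ 0 := Complex.ofReal_ne_zero.2 hε.ne'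
  refine ⟨ε, hε, ?_⟩
  have hspec : spectrum ℂ (1 - (ε : ℂ) • a) = {1} - Units.mk0 (ε : ℂ) hε' • spectrum ℂ a := by
    rw [← spectrum.unit_smul_eq_smul, spectrum.singleton_sub_eq, map_one, Units.smul_mk0]
  rw [hspec]
  rintro - ⟨-, rfl, -, ⟨z, hz, rfl⟩, rfl⟩
  have hz' : ε * ‖z‖ ^ 2 ≤ z.re :=
    (le_div_iff₀ (pow_pos (norm_pos_iff.2 (hne z hz)) 2)).1 (hεle z hz)
  have hsq : ‖1 - (ε : ℂ) * z‖ ^ 2 = 1 - 2 * ε * z.re + ε * (ε * ‖z‖ ^ 2) := by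
    simp only [← Complex.normSq_eq_norm_sq, Complex.normSq_apply, Complex.sub_re, Complex.sub_im,
      Complex.re_ofReal_mul, Complex.im_ofReal_mul, Complex.one_re, Complex.one_im]
    ring
  have hlt : ‖1 - (ε : ℂ) * z‖ ^ 2 < 1 := by
    nlinarith [mul_le_mul_of_nonneg_left hz' hε.le, mul_pos hε (ha z hz)]
  exact (sq_lt_one_iff₀ (norm_nonneg _)).1 hlt

theorem exists_norm_pow_lt_one_of_spectrum {𝔸 : Type*} [NormedRing 𝔸] [NormedAlgebra ℂ 𝔸]
    [CompleteSpace 𝔸] {b : 𝔸} (hb : ∀ z ∈ spectrum ℂ b, ‖z‖ < 1) : ∃ m : ℕ, ‖b ^ m‖ < 1 := by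
  rcases subsingleton_or_nontrivial 𝔸 with h | h
  · exact ⟨0, by simp [Subsingleton.elim (1 : 𝔸) 0]⟩
  have hrad : spectralRadius ℂ b < (1 : NNReal) :=
    spectrum.spectralRadius_lt_of_forall_lt b fun z hz => hb z hz
  obtain ⟨m, hm⟩ := ((spectrum.pow_nnnorm_pow_one_div_tendsto_nhds_spectralRadius
    b).eventually_lt_const hrad).exists
  refine ⟨m, lt_of_not_ge fun h1 => hm.not_ge ?_⟩
  simpa using ENNReal.rpow_le_rpow (ENNReal.one_le_coe_iff.2 h1) (by positivity : 0 ≤ 1 / (m : ℝ))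

theorem norm_toEuclideanCLM_le_norm_map {ι : Type*} [Fintype ι] [DecidableEq ι]
    (A : Matrix ι ι ℝ) :
    ‖toEuclideanCLM (𝕜 := ℝ) A‖ ≤ ‖toEuclideanCLM (𝕜 := ℂ) (A.map (algebraMap ℝ ℂ))‖ := by
  let J (x : EuclideanSpace ℝ ι) : EuclideanSpace ℂ ι := WithLp.toLp 2 fun i => (x i : ℂ)
  have hJ (x) : ‖J x‖ = ‖x‖ := by simp [J, EuclideanSpace.norm_eq]
  have hJA (x) : J (toEuclideanCLM (𝕜 := ℝ) A x) =
      toEuclideanCLM (𝕜 := ℂ) (A.map (algebraMap ℝ ℂ)) (J x) := by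
    ext i
    simp [J, mulVec, dotProduct]
  refine ContinuousLinearMap.opNorm_le_bound _ (norm_nonneg _) fun x => ?_
  rw [← hJ, hJA, ← hJ x]
  exact ContinuousLinearMap.le_opNorm _ _

theorem exists_norm_pow_one_sub_smul_lt_one {ι : Type*} [Fintype ι] [DecidableEq ι]
    {A : Matrix ι ι ℝ} (hA : ∀ z ∈ spectrum ℂ (A.map (algebraMap ℝ ℂ)), 0 < z.re) :
    ∃ ε : ℝ, 0 < ε ∧ ∃ m : ℕ, ‖(1 - ε • toEuclideanCLM (𝕜 := ℝ) A) ^ m‖ < 1 := by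
  have ha : ∀ z ∈ spectrum ℂ (toEuclideanCLM (𝕜 := ℂ) (A.map (algebraMap ℝ ℂ))), 0 < z.re := by
    rwa [AlgEquiv.spectrum_eq]
  obtain ⟨ε, hε, hspec⟩ := exists_forall_norm_lt_one_of_spectrum_re_pos ha
  obtain ⟨m, hm⟩ := exists_norm_pow_lt_one_of_spectrum hspec
  have hreal : (1 - ε • toEuclideanCLM (𝕜 := ℝ) A) ^ m =
      toEuclideanCLM (𝕜 := ℝ) ((1 - ε • A) ^ m) := by simp
  have hcomplex : (1 - (ε : ℂ) • toEuclideanCLM (𝕜 := ℂ) (A.map (algebraMap ℝ ℂ))) ^ m =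
      toEuclideanCLM (𝕜 := ℂ) (((1 - ε • A) ^ m).map (algebraMap ℝ ℂ)) := by
    have hmap : (1 - ε • A).map (algebraMap ℝ ℂ) = 1 - (ε : ℂ) • A.map (algebraMap ℝ ℂ) := by
      ext i j
      simp [Matrix.one_apply, apply_ite]
    have hpow : ((1 - ε • A) ^ m).map (algebraMap ℝ ℂ) =
        (1 - (ε : ℂ) • A.map (algebraMap ℝ ℂ)) ^ m :=
      (map_pow (algebraMap ℝ ℂ).mapMatrix _ m).trans (congrArg (· ^ m) hmap)
    rw [hpow, map_pow, map_sub, map_one, map_smul]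
  refine ⟨ε, hε, m, (hreal ▸ norm_toEuclideanCLM_le_norm_map _).trans_lt ?_⟩
  rwa [← hcomplex]

section OrbitSegment

variable {E : Type*} [NormedAddCommGroup E] [InnerProductSpace ℝ E]

/-- The map `x ↦ (x, B x, …, B ^ (m - 1) x)` into the `ℓ²` sum of `m` copies of `E`. Pulling back
the norm along it gives the Lyapunov norm of `B`. -/
noncomputable def orbitSegment (B : E →L[ℝ] E) (m : ℕ) : E →L[ℝ] PiLp 2 (fun _ : Fin m => E) :=
  (PiLp.continuousLinearEquiv 2 ℝ (fun _ : Fin m => E)).symm.toContinuousLinearMap ∘L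
    ContinuousLinearMap.pi fun k => B ^ (k : ℕ)

theorem norm_sq_orbitSegment (B : E →L[ℝ] E) (m : ℕ) (x : E) :
    ‖orbitSegment B m x‖ ^ 2 = ∑ k ∈ Finset.range m, ‖(B ^ k) x‖ ^ 2 := by
  rw [PiLp.norm_sq_eq_of_L2, Finset.sum_range]
  rfl

theorem norm_sq_orbitSegment_map (B : E →L[ℝ] E) (m : ℕ) (x : E) :
    ‖orbitSegment B m (B x)‖ ^ 2 + ‖x‖ ^ 2 = ‖orbitSegment B m x‖ ^ 2 + ‖(B ^ m) x‖ ^ 2 := by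
  have h := Finset.sum_range_succ' (fun k => ‖(B ^ k) x‖ ^ 2) m
  rw [Finset.sum_range_succ] at h
  rw [norm_sq_orbitSegment, norm_sq_orbitSegment, h]
  rfl

theorem le_inner_orbitSegment_one_sub_smul (A : E →L[ℝ] E) (ε : ℝ) (m : ℕ) (x : E) :
    (1 - ‖(1 - ε • A) ^ m‖ ^ 2) * ‖x‖ ^ 2 ≤
      2 * ε * inner ℝ (orbitSegment (1 - ε • A) m x) (orbitSegment (1 - ε • A) m (A x)) := by
  set B := 1 - ε • A
  set T := orbitSegment B m
  have htel : ‖T (B x)‖ ^ 2 + ‖x‖ ^ 2 = ‖T x‖ ^ 2 + ‖(B ^ m) x‖ ^ 2 :=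
    norm_sq_orbitSegment_map B m x
  have hexpand : ‖T (B x)‖ ^ 2 =
      ‖T x‖ ^ 2 - 2 * ε * inner ℝ (T x) (T (A x)) + ‖ε • T (A x)‖ ^ 2 := by
    have hTB : T (B x) = T x - ε • T (A x) := by simp [B]
    rw [hTB, norm_sub_sq_real, real_inner_smul_right, mul_assoc]
  have hpow : ‖(B ^ m) x‖ ^ 2 ≤ ‖B ^ m‖ ^ 2 * ‖x‖ ^ 2 := by
    rw [← mul_pow]
    gcongr
    exact (B ^ m).le_opNorm x
  linarith [sq_nonneg ‖ε • T (A x)‖]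

end OrbitSegment

theorem isExpanding_conj_iff {V E : Type*} [NormedAddCommGroup V] [NormedSpace ℝ V]
    [NormedAddCommGroup E] [InnerProductSpace ℝ E] {A : V →L[ℝ] V} {e : V ≃L[ℝ] E} :
    IsExpanding (e.conjContinuousAlgEquiv A) ↔
      ∃ c > 0, ∀ x, c * ‖e x‖ ^ 2 ≤ inner ℝ (e x) (e (A x)) := by
  simp [IsExpanding, e.surjective.forall]

theorem exists_isExpanding_conj_of_injective {V F ι : Type*} [NormedAddCommGroup V]
    [NormedSpace ℝ V] [FiniteDimensional ℝ V] [NormedAddCommGroup F] [InnerProductSpace ℝ F]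
    [Fintype ι] (hι : Module.finrank ℝ V = Fintype.card ι) {A : V →L[ℝ] V} {T : V →L[ℝ] F}
    (hT : Function.Injective T) {c : ℝ} (hc : 0 < c)
    (hA : ∀ x, c * ‖T x‖ ^ 2 ≤ inner ℝ (T x) (T (A x))) :
    ∃ e : V ≃L[ℝ] EuclideanSpace ℝ ι, IsExpanding (e.conjContinuousAlgEquiv A) := by
  let eRange : V ≃ₗ[ℝ] LinearMap.range T.toLinearMap := LinearEquiv.ofInjective T.toLinearMap hT
  have hdim : Fintype.card ι = Module.finrank ℝ (LinearMap.range T.toLinearMap) := by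
    rw [← eRange.finrank_eq, hι]
  let u : LinearMap.range T.toLinearMap ≃ₗᵢ[ℝ] EuclideanSpace ℝ ι :=
    ((stdOrthonormalBasis ℝ _).reindex (Fintype.equivFinOfCardEq hdim).symm).repr
  refine ⟨eRange.toContinuousLinearEquiv.trans u.toContinuousLinearEquiv,
    isExpanding_conj_iff.2 ⟨c, hc, fun x => ?_⟩⟩
  simpa [eRange] using hA x

theorem exists_isExpanding_conj_mulVecLin {ι : Type*} [Fintype ι] [DecidableEq ι]
    {A : Matrix ι ι ℝ} (hA : ∀ z ∈ spectrum ℂ (A.map (algebraMap ℝ ℂ)), 0 < z.re) :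
    ∃ e : (ι → ℝ) ≃L[ℝ] EuclideanSpace ℝ ι,
      IsExpanding (e.conjContinuousAlgEquiv A.mulVecLin.toContinuousLinearMap) := by
  obtain ⟨ε, hε, m, hm⟩ := exists_norm_pow_one_sub_smul_lt_one hA
  let ℓ : (ι → ℝ) ≃L[ℝ] EuclideanSpace ℝ ι := (EuclideanSpace.equiv ι ℝ).symm
  let a : EuclideanSpace ℝ ι →L[ℝ] EuclideanSpace ℝ ι := toEuclideanCLM (𝕜 := ℝ) A
  let T := orbitSegment (1 - ε • a) m
  set q : ℝ := 1 - ‖(1 - ε • a) ^ m‖ ^ 2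
  have hq : 0 < q := sub_pos.2 (pow_lt_one₀ (norm_nonneg _) hm two_ne_zero)
  have hinner (x) : q * ‖x‖ ^ 2 ≤ 2 * ε * inner ℝ (T x) (T (a x)) :=
    le_inner_orbitSegment_one_sub_smul a ε m x
  have hTinj : Function.Injective T := (injective_iff_map_eq_zero T).2 fun x hx => by
    have h := hinner x
    rw [hx, inner_zero_left, mul_zero] at h
    simpa using nonpos_of_mul_nonpos_right h hq
  refine exists_isExpanding_conj_of_injective (T := T ∘L ℓ.toContinuousLinearMap) (by simp)
    (hTinj.comp ℓ.injective) (c := q / (2 * ε * (‖T‖ ^ 2 + 1))) (by positivity) fun x => ?_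
  change _ ≤ inner ℝ (T (ℓ x)) (T (a (ℓ x)))
  have hle : ‖T (ℓ x)‖ ^ 2 ≤ (‖T‖ ^ 2 + 1) * ‖ℓ x‖ ^ 2 :=
    calc ‖T (ℓ x)‖ ^ 2 ≤ (‖T‖ * ‖ℓ x‖) ^ 2 := by gcongr; exact T.le_opNorm _
      _ ≤ (‖T‖ ^ 2 + 1) * ‖ℓ x‖ ^ 2 := by
        rw [mul_pow]
        gcongr
        linarith
  rw [div_mul_eq_mul_div, div_le_iff₀ (by positivity)]
  calc q * ‖T (ℓ x)‖ ^ 2 ≤ q * ((‖T‖ ^ 2 + 1) * ‖ℓ x‖ ^ 2) := by gcongr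
    _ = (‖T‖ ^ 2 + 1) * (q * ‖ℓ x‖ ^ 2) := by ring
    _ ≤ (‖T‖ ^ 2 + 1) * (2 * ε * inner ℝ (T (ℓ x)) (T (a (ℓ x)))) :=
        mul_le_mul_of_nonneg_left (hinner _) (by positivity)
    _ = _ := by ring

end LyapunovNorm

namespace ObsSystem

section Hyperbolic

open scoped Topology

variable {ι κ : Type*} {p : ℕ}

theorem extend_zero (S : ObsSystem ι p) (U : Matrix κ κ ℝ) : S.extend 0 U = S.join ⟨U, 0⟩ := rfl

theorem reverse_reverse (S : ObsSystem ι p) : S.reverse.reverse = S := by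
  simp [reverse]

theorem reverse_extend (S : ObsSystem ι p) (L : Matrix κ ι ℝ) (U : Matrix κ κ ℝ) :
    (S.extend L U).reverse = S.reverse.extend (-L) (-U) := by
  simp [reverse, extend, fromBlocks_neg]

variable {E F : Type*} [NormedAddCommGroup E] [InnerProductSpace ℝ E]
  [NormedAddCommGroup F] [InnerProductSpace ℝ F]

/-- The Euclidean coordinates `e` and `f` on two state spaces, combined to coordinates on the state
space of a composite system in which the two factors are orthogonal. -/
noncomputable def glue (e : (ι → ℝ) ≃L[ℝ] E) (f : (κ → ℝ) ≃L[ℝ] F) :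
    (ι ⊕ κ → ℝ) ≃L[ℝ] WithLp 2 (E × F) :=
  (ContinuousLinearEquiv.sumPiEquivProdPi ℝ ι κ fun _ => ℝ).trans
    ((e.prodCongr f).trans (WithLp.prodContinuousLinearEquiv 2 ℝ E F).symm)

theorem glue_apply (e : (ι → ℝ) ≃L[ℝ] E) (f : (κ → ℝ) ≃L[ℝ] F) (x : ι ⊕ κ → ℝ) :
    glue e f x = WithLp.toLp 2 (e (x ∘ Sum.inl), f (x ∘ Sum.inr)) := rfl

variable [Fintype ι] [Fintype κ]

theorem topEquiv_of_isExpanding [CompleteSpace E] {S T : ObsSystem ι p} {R : ObsSystem κ p}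
    {φ : (ι → ℝ) →ₗ[ℝ] (κ → ℝ)} (hS : Intertwines S R φ) (hT : Intertwines T R φ)
    (e : (ι → ℝ) ≃L[ℝ] E) (hSe : IsExpanding (e.conjContinuousAlgEquiv S.field))
    (hTe : IsExpanding (e.conjContinuousAlgEquiv T.field)) : S.TopEquiv T := by
  let H : (ι → ℝ) ≃ₜ (ι → ℝ) :=
    e.toHomeomorph.trans ((hSe.orbitHomeomorph hTe).trans e.symm.toHomeomorph)
  have hH (x) : H x = e.symm (orbitMap (e.conjContinuousAlgEquiv S.field)
    (e.conjContinuousAlgEquiv T.field) (e x)) := rfl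
  refine topEquiv_iff.2 ⟨H, fun t x => ?_, fun x => ?_⟩
  · have hx : e (linearFlow S.field t x) =
        linearFlow (e.conjContinuousAlgEquiv S.field) t (e x) :=
      map_linearFlow (P := e.toContinuousLinearMap) (fun x => by simp) t x
    rw [hH, hH, hx, hSe.orbitMap_linearFlow]
    exact map_linearFlow (P := e.symm.toContinuousLinearMap) (fun y => by simp) t _
  · have hφ : φ (H x) = φ x := by
      rw [hH]
      simpa using map_orbitMap (P := φ.toContinuousLinearMap ∘L e.symm.toContinuousLinearMap)
        (D := R.field) (fun y => by simp [hS.map_state]) (fun y => by simp [hT.map_state]) (e x)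
    rw [← hT.output_map, hφ, hS.output_map]

theorem linEquiv_extend_smul (S : ObsSystem ι p) (L : Matrix κ ι ℝ) (U : Matrix κ κ ℝ) {r : ℝ}
    (hr : r ≠ 0) : (S.extend L U).LinEquiv (S.extend (r • L) U) := by
  let scale := (LinearEquiv.sumArrowLequivProdArrow ι κ ℝ ℝ).trans
    (((LinearEquiv.refl ℝ _).prodCongr (LinearEquiv.smulOfNeZero ℝ _ r hr)).trans
      (LinearEquiv.sumArrowLequivProdArrow ι κ ℝ ℝ).symm)
  have hscale (x) : scale x = Sum.elim (x ∘ Sum.inl) (r • (x ∘ Sum.inr)) := rfl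
  refine linEquiv_iff.2 ⟨scale, fun x => ?_, fun x => ?_⟩
  · simp [hscale, extend, fromBlocks_mulVec, smul_mulVec, mulVec_smul]
  · simp [hscale, extend, fromCols_mulVec]

theorem isExpanding_glue_join {S : ObsSystem ι p} {T : ObsSystem κ p} {e : (ι → ℝ) ≃L[ℝ] E}
    {f : (κ → ℝ) ≃L[ℝ] F} (hS : IsExpanding (e.conjContinuousAlgEquiv S.field))
    (hT : IsExpanding (f.conjContinuousAlgEquiv T.field)) :
    IsExpanding ((glue e f).conjContinuousAlgEquiv (S.join T).field) := by
  rw [isExpanding_conj_iff] at hS hT ⊢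
  obtain ⟨c, hc, hSc⟩ := hS
  obtain ⟨d, hd, hTd⟩ := hT
  refine ⟨min c d, lt_min hc hd, fun x => ?_⟩
  rw [WithLp.prod_norm_sq_eq_of_L2, WithLp.prod_inner_apply, mul_add]
  simp only [glue_apply, field_apply, join, fromBlocks_mulVec, zero_mulVec, add_zero, zero_add,
    Sum.elim_comp_inl, Sum.elim_comp_inr]
  refine add_le_add ?_ ?_
  · exact (mul_le_mul_of_nonneg_right (min_le_left c d) (sq_nonneg _)).trans (hSc _)
  · exact (mul_le_mul_of_nonneg_right (min_le_right c d) (sq_nonneg _)).trans (hTd _)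

theorem exists_isExpanding_glue_extend_smul {S : ObsSystem ι p} (L : Matrix κ ι ℝ)
    {U : Matrix κ κ ℝ} {e : (ι → ℝ) ≃L[ℝ] E} {f : (κ → ℝ) ≃L[ℝ] F}
    (hS : IsExpanding (e.conjContinuousAlgEquiv S.field))
    (hU : IsExpanding (f.conjContinuousAlgEquiv U.mulVecLin.toContinuousLinearMap)) :
    ∃ r : ℝ, r ≠ 0 ∧
      IsExpanding ((glue e f).conjContinuousAlgEquiv (S.extend (r • L) U).field) := by
  let Φ (r : ℝ) := (glue e f).conjContinuousAlgEquiv (S.extend (r • L) U).field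
  have hΦ : Continuous Φ := by
    have hfield (r : ℝ) : (S.extend (r • L) U).field = (S.extend 0 U).field +
        r • (fromBlocks 0 0 L 0 : Matrix (ι ⊕ κ) (ι ⊕ κ) ℝ).mulVecLin.toContinuousLinearMap := by
      ext x i
      rcases i with i | i <;> simp [extend, fromBlocks_mulVec, smul_mulVec, add_comm]
    simp only [Φ, hfield]
    fun_prop
  have hΦ₀ : IsExpanding (Φ 0) := by
    simp only [Φ, zero_smul, extend_zero]
    exact isExpanding_glue_join hS hU
  have hev : ∀ᶠ r in 𝓝[≠] (0 : ℝ), IsExpanding (Φ r) :=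
    (hΦ.continuousAt.eventually hΦ₀.eventually_nhds).filter_mono nhdsWithin_le_nhds
  exact (eventually_mem_nhdsWithin.and hev).exists

variable [DecidableEq ι] [DecidableEq κ]

theorem topEquiv_extend_of_re_pos {S : ObsSystem ι p} {L : Matrix κ ι ℝ} {U : Matrix κ κ ℝ}
    (h : (S.extend L U).EigenvaluesSatisfy fun z => 0 < z.re) :
    (S.extend L U).TopEquiv (S.extend 0 (1 : Matrix κ κ ℝ)) := by
  obtain ⟨hS, hU⟩ := eigenvaluesSatisfy_extend.1 h
  obtain ⟨e, he⟩ := exists_isExpanding_conj_mulVecLin hS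
  obtain ⟨f, hf⟩ := exists_isExpanding_conj_mulVecLin hU
  -- Rescaling the unobserved coordinates makes the coupling `L` a small perturbation.
  obtain ⟨r, hr, hexp⟩ := exists_isExpanding_glue_extend_smul L he hf
  have hone : IsExpanding (f.conjContinuousAlgEquiv (⟨1, 0⟩ : ObsSystem κ p).field) :=
    isExpanding_conj_iff.2 ⟨1, one_pos, fun x => by simp⟩
  have hjoin : IsExpanding ((glue e f).conjContinuousAlgEquiv
      (S.extend 0 (1 : Matrix κ κ ℝ)).field) := by
    rw [extend_zero]
    exact isExpanding_glue_join he hone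
  have hflow : (S.extend (r • L) U).TopEquiv (S.extend 0 (1 : Matrix κ κ ℝ)) :=
    topEquiv_of_isExpanding (intertwines_extend S _ _) (intertwines_extend S _ _) (glue e f)
      hexp hjoin
  exact (linEquiv_extend_smul S L U hr).topEquiv.trans hflow

theorem topEquiv_extend_of_re_neg {S : ObsSystem ι p} {L : Matrix κ ι ℝ} {U : Matrix κ κ ℝ}
    (h : (S.extend L U).EigenvaluesSatisfy fun z => z.re < 0) :
    (S.extend L U).TopEquiv (S.extend 0 (-1 : Matrix κ κ ℝ)) := by
  have hrev : (S.reverse.extend (-L) (-U)).EigenvaluesSatisfy fun z => 0 < z.re := by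
    rw [← reverse_extend]
    exact h.reverse.mono fun z hz => by simpa using hz
  simpa only [reverse_extend, reverse_reverse, neg_neg, neg_zero]
    using (topEquiv_extend_of_re_pos hrev).reverse

end Hyperbolic

section Classification

variable {ι κ κ₀ : Type*} {p : ℕ}

theorem signSystem_eq_join (a b p : ℕ) : signSystem a b p =
    join ⟨(1 : Matrix (Fin a) (Fin a) ℝ), 0⟩ ⟨(-1 : Matrix (Fin b) (Fin b) ℝ), 0⟩ := by
  ext (i | i) (j | j) <;> simp [signSystem, join, diagonal_apply, one_apply, neg_ite]

variable [Fintype ι] [Fintype κ] [Fintype κ₀] [DecidableEq κ]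

theorem IsObservablePart.exists_linEquiv_extend {S : ObsSystem ι p} {T : ObsSystem κ p}
    (h : S.IsObservablePart T) {m : ℕ} (hm : Fintype.card κ + m = Fintype.card ι) :
    ∃ (L : Matrix (Fin m) κ ℝ) (U : Matrix (Fin m) (Fin m) ℝ), S.LinEquiv (T.extend L U) := by
  obtain ⟨-, m', L, U, hlin⟩ := h
  obtain rfl : m' = m := by
    obtain ⟨H, -⟩ := hlin
    have hcard := H.finrank_eq
    simp only [Module.finrank_fintype_fun_eq_card, Fintype.card_sum, Fintype.card_fin] at hcard
    lia
  exact ⟨L, U, hlin⟩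

theorem IsObservablePart.topEquiv_join_one [DecidableEq ι] {S : ObsSystem ι p}
    {T : ObsSystem κ p} (h : S.IsObservablePart T)
    (hS : S.EigenvaluesSatisfy fun z => 0 < z.re) {m : ℕ}
    (hm : Fintype.card κ + m = Fintype.card ι) :
    S.TopEquiv (T.join ⟨(1 : Matrix (Fin m) (Fin m) ℝ), 0⟩) := by
  obtain ⟨L, U, hlin⟩ := h.exists_linEquiv_extend hm
  exact hlin.topEquiv.trans (topEquiv_extend_of_re_pos (hlin.eigenvaluesSatisfy_iff.1 hS))

theorem IsObservablePart.topEquiv_join_neg_one [DecidableEq ι] {S : ObsSystem ι p}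
    {T : ObsSystem κ p} (h : S.IsObservablePart T)
    (hS : S.EigenvaluesSatisfy fun z => z.re < 0) {m : ℕ}
    (hm : Fintype.card κ + m = Fintype.card ι) :
    S.TopEquiv (T.join ⟨(-1 : Matrix (Fin m) (Fin m) ℝ), 0⟩) := by
  obtain ⟨L, U, hlin⟩ := h.exists_linEquiv_extend hm
  exact hlin.topEquiv.trans (topEquiv_extend_of_re_neg (hlin.eigenvaluesSatisfy_iff.1 hS))

namespace SpectralDecomposition

variable {S : ObsSystem ι p} (d : S.SpectralDecomposition)

theorem pos_kobs_le : d.pos.kobs ≤ d.nPos := by simpa using d.pos.kobs_le_card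

theorem neg_kobs_le : d.neg.kobs ≤ d.nNeg := by simpa using d.neg.kobs_le_card

theorem nonzeroRealParts_pos_join_neg : (d.pos.join d.neg).NonzeroRealParts :=
  eigenvaluesSatisfy_join.2 ⟨d.pos_re.mono fun _ h => h.ne', d.neg_re.mono fun _ h => h.ne⟩

variable {d} in
theorem isObservablePart_join {P : ObsSystem κ p} {Q : ObsSystem κ₀ p} [DecidableEq κ₀]
    (hP : d.pos.IsObservablePart P) (hQ : d.neg.IsObservablePart Q) :
    (d.pos.join d.neg).IsObservablePart (P.join Q) :=
  hP.join hQ <| (hP.eigenvaluesSatisfy d.pos_re).isCoprime (hQ.eigenvaluesSatisfy d.neg_re)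
    fun _ hpos hneg => hpos.not_gt hneg

theorem exists_isObservablePart_pos_join_neg :
    ∃ O : ObsSystem (Fin (d.pos.kobs + d.neg.kobs)) p, (d.pos.join d.neg).IsObservablePart O := by
  obtain ⟨P, hP⟩ := d.pos.exists_isObservablePart
  obtain ⟨Q, hQ⟩ := d.neg.exists_isObservablePart
  exact ⟨_, (isObservablePart_join hP hQ).trans_linEquiv (linEquiv_reindex _ finSumFinEquiv)⟩

theorem topEquiv_join_signSystem {N : ObsSystem κ₀ p} {B : ObsSystem κ p}
    (hN : d.zero.LinEquiv N) (hB : (d.pos.join d.neg).IsObservablePart B) :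
    S.TopEquiv
      (N.join (B.join (signSystem (d.nPos - d.pos.kobs) (d.nNeg - d.neg.kobs) p))) := by
  obtain ⟨P, hP⟩ := d.pos.exists_isObservablePart
  obtain ⟨Q, hQ⟩ := d.neg.exists_isObservablePart
  have hpos := hP.topEquiv_join_one d.pos_re (m := d.nPos - d.pos.kobs)
    (by simpa using Nat.add_sub_of_le d.pos_kobs_le)
  have hneg := hQ.topEquiv_join_neg_one d.neg_re (m := d.nNeg - d.neg.kobs)
    (by simpa using Nat.add_sub_of_le d.neg_kobs_le)
  have hPQ : (P.join Q).LinEquiv B := (isObservablePart_join hP hQ).linEquiv hB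
  rw [signSystem_eq_join]
  exact d.linEquiv.topEquiv.trans <| hN.topEquiv.join <| (hpos.join hneg).trans <|
    ((linEquiv_join_join_join_comm _ _ _ _).trans (hPQ.join (.refl _))).topEquiv

end SpectralDecomposition

end Classification

end ObsSystem

theorem theorem1p3 (n p : ℕ) (A : Matrix (Fin n) (Fin n) ℝ) (C : Matrix (Fin p) (Fin n) ℝ) :
    Nonempty (ObsSystem.SpectralDecomposition (⟨A, C⟩ : ObsSystem (Fin n) p)) ∧
    ∀ d : ObsSystem.SpectralDecomposition (⟨A, C⟩ : ObsSystem (Fin n) p),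
      d.pos.kobs ≤ d.nPos ∧ d.neg.kobs ≤ d.nNeg ∧
      ∀ (R₀ : Set (ObsSystem (Fin d.nZero) p))
        (R₁ : Set (ObsSystem (Fin (d.pos.kobs + d.neg.kobs)) p)),
        ObsSystem.IsLinearCanonicalForm (fun S => S.ZeroRealParts) R₀ →
        ObsSystem.IsLinearCanonicalForm
          (fun S => S.CompletelyObservable ∧ S.NonzeroRealParts) R₁ →
        ∃ (N : Matrix (Fin d.nZero) (Fin d.nZero) ℝ)
          (K : Matrix (Fin p) (Fin d.nZero) ℝ)
          (B : Matrix (Fin (d.pos.kobs + d.neg.kobs)) (Fin (d.pos.kobs + d.neg.kobs)) ℝ)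
          (D : Matrix (Fin p) (Fin (d.pos.kobs + d.neg.kobs)) ℝ),
          (⟨N, K⟩ : ObsSystem _ p) ∈ R₀ ∧ d.zero.LinEquiv ⟨N, K⟩ ∧
          (⟨B, D⟩ : ObsSystem _ p) ∈ R₁ ∧ (d.pos.join d.neg).IsObservablePart ⟨B, D⟩ ∧
          ObsSystem.TopEquiv ⟨A, C⟩
            (ObsSystem.join ⟨N, K⟩ (ObsSystem.join ⟨B, D⟩
              (ObsSystem.signSystem (d.nPos - d.pos.kobs) (d.nNeg - d.neg.kobs) p))) := by
  refine ⟨ObsSystem.nonempty_spectralDecomposition _, fun d =>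
    ⟨d.pos_kobs_le, d.neg_kobs_le, fun R₀ R₁ hR₀ hR₁ => ?_⟩⟩
  obtain ⟨O, hO⟩ := d.exists_isObservablePart_pos_join_neg
  obtain ⟨N, ⟨hN, hNequiv⟩, -⟩ := hR₀.2 d.zero d.zero_re
  obtain ⟨B, ⟨hB, hBequiv⟩, -⟩ :=
    hR₁.2 O ⟨hO.1, hO.eigenvaluesSatisfy d.nonzeroRealParts_pos_join_neg⟩
  have hBobs : (d.pos.join d.neg).IsObservablePart B := hO.trans_linEquiv hBequiv
  exact ⟨N.A, N.C, B.A, B.C, hN, hNequiv, hB, hBobs, d.topEquiv_join_signSystem hNequiv hBobs⟩
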